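/- Let $a,b,q\in\mathbb{C}$ with $|q|<1$, and write $(x;q)_\infty=\prod_{i\ge 0}(1-xq^i)$, $(x;q)_m=\prod_{0\le i<m}(1-xq^i)$ for integers $m\ge 0$, and $(x_1,\dots,x_s;q)_\infty=\prod_{t=1}^{s}(x_t;q)_\infty$. Let the numbers $B_{m,1}(a,b)$ $(m\ge 1)$ be defined by the identity of formal power series $$z=\sum_{m=1}^\infty B_{m,1}(a,b)\,z^m\frac{(az;q)_m}{(bz;q)_m},$$ so that $B_{m,1}(aq,bq)$ are the same numbers with $(a,b)$ replaced by $(aq,bq)$. For integers $m\ge 0$ put $$H_m(z)=\frac{(aqz^2,\,1/(az^2);q)_\infty}{(z,\,b/(az),\,bq^mz,\,1/(az);q)_\infty\,(aqz;q)_m}.$$ Let $n\ge 0$ be an integer and let $r$ be a real number with $|b/a|<r<1$, $|a|r>1$, $|bq|r<1$, with $|b|r<1$ in case $n=0$, and with $|aq^i|r\ne 1$ for $1\le i\le n$. Then $H_n$ and $H_1,\dots,H_n$ have absolutely convergent Laurent expansions $\sum_{j\in\mathbb{Z}}c_jz^j$ on the circle $|z|=r$, with $c_j=\frac{1}{2\pi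 i}\oint_{|z|=r}H(z)z^{-j-1}\,dz$ for the respective function $H$; and, writing $[z^j]\{H(z)\}$ for $c_j$, $$[z^n]\{H_n(z)\}=\frac{1}{(q,b/a;q)_\infty}+aq\sum_{k=0}^{n-1}B_{n-k,1}(aq,bq)\,q^{(n-k)k}\,[z^k]\{H_{k+1}(z)\}.$$ -/

import Mathlib

open scoped Real BigOperators

noncomputable section

/-- The infinite `q`-shifted factorial `(z;q)_∞ = ∏_{i ≥ 0} (1 - z q^i)`. -/
def qPochInf (z q : ℂ) : ℂ := ∏' i : ℕ, (1 - z * q ^ i)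

/-- The finite `q`-shifted factorial `(z;q)_n = ∏_{i < n} (1 - z q^i)`. -/
def qPoch (z q : ℂ) (n : ℕ) : ℂ := ∏ i ∈ Finset.range n, (1 - z * q ^ i)

/-- For `|q| < 1`, `(z;q)_∞ = (z;q)_n (z q^n;q)_∞`, so that `(z;q)_n` is the usual quotient of
infinite `q`-shifted factorials. -/
theorem qPochInf_eq_qPoch_mul (z q : ℂ) (hq : ‖q‖ < 1) (n : ℕ) :
    qPochInf z q = qPoch z q n * qPochInf (z * q ^ n) q := by
  have key : ∀ w : ℂ, qPochInf w q = (1 - w) * qPochInf (w * q) q := by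
    intro w
    have hs : Summable fun i : ℕ => ‖-(w * q * q ^ i)‖ := by
      simp only [norm_neg, norm_mul, norm_pow]
      exact (summable_geometric_of_lt_one (norm_nonneg _) hq).mul_left _
    have hm : Multipliable fun i : ℕ => (1 - w * q ^ (i + 1)) := by
      have := multipliable_one_add_of_summable hs
      refine this.congr fun i => ?_
      ring
    have h := tprod_eq_zero_mul' (f := fun i : ℕ => (1 - w * q ^ i)) hm
    simp only [qPochInf]
    rw [h]
    simp only [pow_zero, mul_one]
    congr 2
    funext i
    ring
  induction n with
  | zero => simp [qPoch]
  | succ n ih =>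
    rw [ih, key (z * q ^ n), qPoch, qPoch, Finset.prod_range_succ, pow_succ]
    ring_nf

/-- `(cz;q)_k` as a formal power series in `z`. -/
def qPochSeries (c q : ℂ) (k : ℕ) : PowerSeries ℂ :=
  ∏ i ∈ Finset.range k, (1 - PowerSeries.C (c * q ^ i) * PowerSeries.X)

/-- The formal power series `z^k (az;q)_k / (bz;q)_k`. -/
def baseSeries (a b q : ℂ) (k : ℕ) : PowerSeries ℂ :=
  PowerSeries.X ^ k * qPochSeries a q k * (qPochSeries b q k)⁻¹

/-- The coefficients `B_{n,k}(a,b)` of the expansion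
`z^k = ∑_n B_{n,k}(a,b) z^n (az;q)_n / (bz;q)_n` in `ℂ⟦z⟧`, computed by comparing the
coefficients of `z^n`. -/
def invCoeff (a b q : ℂ) (n k : ℕ) : ℂ :=
  (if n = k then 1 else 0) -
    ∑ i : Fin n, invCoeff a b q i k * PowerSeries.coeff n (baseSeries a b q i)
termination_by n

theorem coeff_baseSeries_self (a b q : ℂ) (n : ℕ) :
    PowerSeries.coeff n (baseSeries a b q n) = 1 := by
  have h : ∀ c : ℂ, PowerSeries.constantCoeff (qPochSeries c q n) = 1 := by
    intro c
    simp [qPochSeries, map_prod]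
  rw [baseSeries, mul_assoc, PowerSeries.coeff_X_pow_mul']
  simp [h]

theorem coeff_baseSeries_of_lt (a b q : ℂ) {n k : ℕ} (h : n < k) :
    PowerSeries.coeff n (baseSeries a b q k) = 0 := by
  rw [baseSeries, mul_assoc, PowerSeries.coeff_X_pow_mul', if_neg (by omega)]

/-- A sequence `β` satisfies `z^k = ∑_n β_n z^n (az;q)_n / (bz;q)_n` in `ℂ⟦z⟧` (where the
`n`-th term has order at least `n`, so only `n ≤ N` contribute to the coefficient of `z^N`)
exactly if `β_n = B_{n,k}(a,b)` for all `n`. -/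
theorem expansion_iff_eq_invCoeff (a b q : ℂ) (k : ℕ) (β : ℕ → ℂ) :
    (∀ N : ℕ, PowerSeries.coeff N (PowerSeries.X ^ k : PowerSeries ℂ) =
      ∑ n ∈ Finset.range (N + 1), β n * PowerSeries.coeff N (baseSeries a b q n)) ↔
    ∀ n, β n = invCoeff a b q n k := by
  have step : ∀ N : ℕ, ∀ γ : ℕ → ℂ,
      (PowerSeries.coeff N (PowerSeries.X ^ k : PowerSeries ℂ) =
        ∑ n ∈ Finset.range (N + 1), γ n * PowerSeries.coeff N (baseSeries a b q n)) ↔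
      γ N = (if N = k then 1 else 0) -
        ∑ i : Fin N, γ i * PowerSeries.coeff N (baseSeries a b q i) := by
    intro N γ
    rw [Finset.sum_range_succ, coeff_baseSeries_self, PowerSeries.coeff_X_pow, mul_one,
      Finset.sum_range, eq_sub_iff_add_eq, add_comm]
    exact eq_comm
  constructor
  · intro h n
    induction n using Nat.strong_induction_on with
    | _ n ih =>
      rw [(step n β).1 (h n), invCoeff]
      congr 1
      refine Finset.sum_congr rfl fun i _ => ?_
      rw [ih i i.2]
  · intro h N
    rw [step, h N, invCoeff]
    congr 1
    refine Finset.sum_congr rfl fun i _ => ?_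
    rw [h i]

/-- The coefficient of `z^j` in the Laurent expansion of `F` on the circle `|z| = r`. -/
def laurentCoeff (r : ℝ) (j : ℤ) (F : ℂ → ℂ) : ℂ :=
  (2 * (π : ℂ) * Complex.I)⁻¹ * ∮ z in C(0, r), F z * z ^ (-j - 1)

/-- On the circle `|z| = r`, `F` is the sum of the absolutely convergent two-sided series
`∑_{j ∈ ℤ} [z^j]{F} z^j`. -/
def HasLaurentExpansion (r : ℝ) (F : ℂ → ℂ) : Prop :=
  ∀ z : ℂ, ‖z‖ = r → HasSum (fun j : ℤ => laurentCoeff r j F * z ^ j) (F z)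

/-- The function
`(aqz², 1/(az²);q)_∞ / ((z, b/(az), b q^m z, 1/(az);q)_∞ (aqz;q)_m)`. -/
def psiQuot (a b q : ℂ) (m : ℕ) (z : ℂ) : ℂ :=
  (qPochInf (a * q * z ^ 2) q * qPochInf (1 / (a * z ^ 2)) q) /
    (qPochInf z q * qPochInf (b / (a * z)) q * qPochInf (b * q ^ m * z) q *
      qPochInf (1 / (a * z)) q * qPoch (a * q * z) q m)

end

/-!
The proof rests on the Laurent coefficients of the theta quotients
`(aqz², 1/(az²);q)_∞ / (cz, dz, e/(az), f/(az);q)_∞` (`thetaQuot`) on a circle in the annulus where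
no factor of the denominator can vanish. Two symmetries control them. The `q`-difference equation
`thetaQuot_qshift`, with the contour moved from `|z| = r` to `|z| = |q| r`, gives a recurrence
(`laurentCoeff_thetaQuot_recurrence`). In the symmetric case `(e, f) = (c, d)` the reflection
`z ↦ 1/(az)` makes the coefficients antisymmetric (`laurentCoeff_thetaQuot_symm`). Combined, these show
that replacing `d` by `dq` multiplies the constant term by `1 - cd/a`, so that letting `d` and then
`c` tend to `0` along powers of `q` reduces it to the constant term of the theta function (`laurentCoeff_theta`). This
proves `laurentCoeff_thetaQuot_zero`: the constant term is `1/(q, cd/a;q)_∞`, which is the claim for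
`n = 0`.

For `n ≥ 1` every `H_m = psiQuot a b q m` with `1 ≤ m ≤ n` is a rational function times the kernel
`K = thetaQuot a 1 (b * q) 1 b q`. The kernel is not symmetric, but `(1 - b/(az)) K` is. Comparing
the two gives the coefficients of `K` of small index (`kernel_initial`), and the recurrence then
identifies all the others:
`∑_{n ≥ 0} [zⁿ]{K} xⁿ = 1/(q, b/a;q)_∞ · ∑ₖ φₖ(x)`, `φₖ(x) = xᵏ (aqx;q)ₖ/(bqx;q)ₖ`
(`laurentCoeff_kernel`), because both sides satisfy the functional equation that one step of the
Rogers–Fine iteration yields for the right-hand side (`sum_baseSeries_functional`).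

Finally, a telescoping sum expands `x/(z - x)` in the products `φₖ(x) z⁻ᵏ (bqz;q)_{k-1}/(aqz;q)ₖ`
(`coeff_sum_baseSeries_telescope`). Its constant term against `K` is a triangular linear system
relating `[zᵏ]{Hₖ}` and `[zᵏ]{H_{k+1}}`, with coefficients taken from the `φₖ`. The expansion of `x`
in the `φₖ` that defines the numbers `B_{m,1}(aq,bq)` inverts this system (`eq_add_sum_invCoeff`).

The Laurent expansions exist because each `H_m` is holomorphic near the circle: its coefficients
decay geometrically on both sides, so its Fourier series on the circle converges absolutely.
-/

section

open Filter Topology Complex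

/-! ### Infinite `q`-shifted factorials -/

theorem summable_norm_mul_pow {q : ℂ} (hq : ‖q‖ < 1) (z : ℂ) :
    Summable fun i : ℕ => ‖-(z * q ^ i)‖ := by
  simp only [norm_neg, norm_mul, norm_pow]
  exact (summable_geometric_of_lt_one (norm_nonneg _) hq).mul_left _

theorem multipliable_one_sub_mul_pow {q : ℂ} (hq : ‖q‖ < 1) (z : ℂ) :
    Multipliable fun i : ℕ => (1 - z * q ^ i) := by
  simpa [sub_eq_add_neg] using multipliable_one_add_of_summable (summable_norm_mul_pow hq z)

theorem qPochInf_zero_left (q : ℂ) : qPochInf 0 q = 1 := by simp [qPochInf]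

theorem qPochInf_eq_one_sub_mul {q : ℂ} (hq : ‖q‖ < 1) (z : ℂ) :
    qPochInf z q = (1 - z) * qPochInf (z * q) q := by
  simpa [qPoch] using qPochInf_eq_qPoch_mul z q hq 1

theorem qPochInf_zero_right (z : ℂ) : qPochInf z 0 = 1 - z := by
  simpa [qPochInf_zero_left] using qPochInf_eq_one_sub_mul (q := 0) (by simp) z

theorem qPoch_succ (z q : ℂ) (n : ℕ) : qPoch z q (n + 1) = qPoch z q n * (1 - z * q ^ n) :=
  Finset.prod_range_succ _ _

theorem qPochInf_ne_zero {z q : ℂ} (hq : ‖q‖ < 1) (hz : ‖z‖ < 1) : qPochInf z q ≠ 0 := by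
  have h := tprod_one_add_ne_zero_of_summable (f := fun i : ℕ => -(z * q ^ i)) (fun i h => ?_)
    (summable_norm_mul_pow hq z)
  · simpa [qPochInf, sub_eq_add_neg] using h
  · have h1 : z * q ^ i = 1 := by linear_combination -h
    have h2 : ‖z * q ^ i‖ < 1 := by
      rw [norm_mul, norm_pow]
      exact mul_lt_one_of_nonneg_of_lt_one_left (norm_nonneg _) hz
        (pow_le_one₀ (norm_nonneg _) hq.le)
    rw [h1] at h2
    simp at h2

theorem tendsto_qPoch {q : ℂ} (hq : ‖q‖ < 1) (z : ℂ) :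
    Tendsto (qPoch z q) atTop (𝓝 (qPochInf z q)) :=
  (multipliable_one_sub_mul_pow hq z).hasProd.tendsto_prod_nat

theorem differentiable_qPochInf {q : ℂ} (hq : ‖q‖ < 1) :
    Differentiable ℂ fun z => qPochInf z q := by
  intro z
  set R := ‖z‖ + 1
  have hu : Summable fun i : ℕ => R * ‖q‖ ^ i :=
    (summable_geometric_of_lt_one (norm_nonneg _) hq).mul_left _
  have h := Summable.hasProdLocallyUniformlyOn_nat_one_add
    (f := fun (i : ℕ) (w : ℂ) => -(w * q ^ i))
    (K := Metric.ball (0 : ℂ) R) Metric.isOpen_ball hu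
    (Eventually.of_forall fun i w hw => by
      rw [norm_neg, norm_mul, norm_pow]
      gcongr
      simpa using (mem_ball_zero_iff.1 hw).le)
    (fun i => by fun_prop)
  have hd := h.differentiableOn (Eventually.of_forall fun s => ?_) Metric.isOpen_ball
  · have := hd.differentiableAt (Metric.isOpen_ball.mem_nhds (x := z) (by simp [R]))
    simpa [qPochInf, sub_eq_add_neg] using this
  · refine DifferentiableOn.fun_finsetProd fun i _ => ?_
    fun_prop

theorem continuous_qPochInf {q : ℂ} (hq : ‖q‖ < 1) : Continuous fun z => qPochInf z q :=
  (differentiable_qPochInf hq).continuous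

theorem differentiable_qPoch (q : ℂ) (n : ℕ) : Differentiable ℂ fun z => qPoch z q n := by
  unfold qPoch
  fun_prop

/-! ### Laurent coefficients on a circle -/

theorem laurentCoeff_eq_circleAverage {r : ℝ} (hr : 0 < r) (j : ℤ) (F : ℂ → ℂ) :
    laurentCoeff r j F = Real.circleAverage (fun z => F z * z ^ (-j)) 0 r := by
  rw [Real.circleAverage_eq_circleIntegral hr.ne', laurentCoeff, smul_eq_mul]
  congr 1
  refine circleIntegral.integral_congr hr.le fun z hz => ?_
  have hz0 : z ≠ 0 := by
    rintro rfl
    simp at hz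
    exact hr.ne hz
  simp only [sub_zero, smul_eq_mul]
  rw [zpow_sub_one₀ hz0]
  ring

theorem laurentCoeff_congr {r : ℝ} (hr : 0 < r) (j : ℤ) {F G : ℂ → ℂ}
    (h : ∀ z, ‖z‖ = r → F z = G z) : laurentCoeff r j F = laurentCoeff r j G := by
  rw [laurentCoeff, laurentCoeff]
  congr 1
  refine circleIntegral.integral_congr hr.le fun z hz => ?_
  simp only [h z (by simpa using hz)]

theorem ne_zero_of_norm_eq {r : ℝ} (hr : 0 < r) {z : ℂ} (hz : ‖z‖ = r) : z ≠ 0 := by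
  rintro rfl
  simp at hz
  exact hr.ne hz

theorem laurentCoeff_zpow_mul {r : ℝ} (hr : 0 < r) (j m : ℤ) (F : ℂ → ℂ) :
    laurentCoeff r j (fun z => z ^ m * F z) = laurentCoeff r (j - m) F := by
  rw [laurentCoeff, laurentCoeff]
  congr 1
  refine circleIntegral.integral_congr hr.le fun z hz => ?_
  have hz0 := ne_zero_of_norm_eq hr (z := z) (by simpa using hz)
  rw [mul_comm (z ^ m), mul_assoc, ← zpow_add₀ hz0]
  congr 2
  ring

theorem laurentCoeff_const_mul (r : ℝ) (j : ℤ) (c : ℂ) (F : ℂ → ℂ) :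
    laurentCoeff r j (fun z => c * F z) = c * laurentCoeff r j F := by
  simp only [laurentCoeff, mul_assoc]
  rw [circleIntegral.integral_const_mul]
  ring

theorem circleIntegrable_mul_zpow {r : ℝ} (hr : 0 < r) (j : ℤ) {F : ℂ → ℂ}
    (hF : ContinuousOn F (Metric.sphere 0 r)) :
    CircleIntegrable (fun z => F z * z ^ j) 0 r := by
  refine ContinuousOn.circleIntegrable hr.le (hF.mul ?_)
  intro z hz
  exact (continuousAt_zpow₀ z j (Or.inl (ne_zero_of_norm_eq hr (by simpa using hz)))
    ).continuousWithinAt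

theorem laurentCoeff_add {r : ℝ} (hr : 0 < r) (j : ℤ) {F G : ℂ → ℂ}
    (hF : ContinuousOn F (Metric.sphere 0 r)) (hG : ContinuousOn G (Metric.sphere 0 r)) :
    laurentCoeff r j (fun z => F z + G z) = laurentCoeff r j F + laurentCoeff r j G := by
  simp only [laurentCoeff, add_mul]
  rw [circleIntegral.integral_add (circleIntegrable_mul_zpow hr _ hF)
    (circleIntegrable_mul_zpow hr _ hG)]
  ring

theorem laurentCoeff_sum {ι : Type*} {r : ℝ} (hr : 0 < r) (j : ℤ) (s : Finset ι)
    {F : ι → ℂ → ℂ} (hF : ∀ i ∈ s, ContinuousOn (F i) (Metric.sphere 0 r)) :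
    laurentCoeff r j (fun z => ∑ i ∈ s, F i z) = ∑ i ∈ s, laurentCoeff r j (F i) := by
  simp only [laurentCoeff, Finset.sum_mul]
  rw [circleIntegral.integral_fun_sum fun i hi => circleIntegrable_mul_zpow hr _ (hF i hi),
    Finset.mul_sum]

/-- Rescaling the variable by a nonzero complex number `s`. -/
theorem laurentCoeff_comp_mul_left {r : ℝ} (hr : 0 < r) (j : ℤ) {s : ℂ} (hs : s ≠ 0) (F : ℂ → ℂ) :
    laurentCoeff r j (fun z => F (s * z)) = s ^ j * laurentCoeff (‖s‖ * r) j F := by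
  have hsr : 0 < ‖s‖ * r := mul_pos (norm_pos_iff.2 hs) hr
  rw [laurentCoeff_eq_circleAverage hr, laurentCoeff_eq_circleAverage hsr,
    Real.circleAverage_eq_integral_add (R := ‖s‖ * r) s.arg, Real.circleAverage_def]
  rw [mul_smul_comm, ← intervalIntegral.integral_const_mul]
  congr 2
  ext θ
  have h : circleMap 0 (‖s‖ * r) (θ + s.arg) = s * circleMap 0 r θ := by
    simp only [circleMap, zero_add]
    conv_rhs => rw [← norm_mul_exp_arg_mul_I s]
    push_cast
    rw [add_mul, Complex.exp_add]
    ring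
  rw [h, mul_zpow, mul_left_comm, ← mul_assoc (s ^ j), ← zpow_add₀ hs]
  simp

/-- Inverting the variable. -/
theorem laurentCoeff_comp_inv {r : ℝ} (hr : 0 < r) (j : ℤ) (F : ℂ → ℂ) :
    laurentCoeff r j (fun z => F z⁻¹) = laurentCoeff r⁻¹ (-j) F := by
  rw [laurentCoeff_eq_circleAverage hr, laurentCoeff_eq_circleAverage (inv_pos.2 hr),
    Real.circleAverage_eq_circleAverage_zero_one,
    Real.circleAverage_eq_circleAverage_zero_one (R := r⁻¹),
    ← Real.circleAverage_zero_one_congr_inv]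
  congr 1
  ext z
  have h : ((r : ℂ) * z⁻¹)⁻¹ = (r⁻¹ : ℝ) * z := by
    push_cast
    rw [mul_inv, inv_inv]
  simp only [add_zero, neg_neg]
  rw [h, ← inv_inv ((r : ℂ) * z⁻¹), h, inv_zpow, zpow_neg, inv_inv]

theorem laurentCoeff_eq_of_differentiableAt_annulus {r R : ℝ} (hr : 0 < r) (hR : 0 < R) (j : ℤ)
    {F : ℂ → ℂ} (hF : ∀ z, min r R ≤ ‖z‖ → ‖z‖ ≤ max r R → DifferentiableAt ℂ F z) :
    laurentCoeff r j F = laurentCoeff R j F := by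
  wlog h : R ≤ r generalizing r R
  · exact (this hR hr (by simpa only [min_comm, max_comm] using hF) (le_of_not_ge h)).symm
  rw [min_eq_right h, max_eq_left h] at hF
  have hd : ∀ z, R ≤ ‖z‖ → ‖z‖ ≤ r → DifferentiableAt ℂ (fun z => F z * z ^ (-j)) z :=
    fun z h1 h2 => (hF z h1 h2).mul
      (differentiableAt_zpow.2 (Or.inl (norm_pos_iff.1 (hR.trans_le h1))))
  rw [laurentCoeff_eq_circleAverage hr, laurentCoeff_eq_circleAverage hR,
    Real.circleAverage_eq_circleIntegral hr.ne', Real.circleAverage_eq_circleIntegral hR.ne']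
  congr 1
  refine Complex.circleIntegral_sub_center_inv_smul_eq_of_differentiable_on_annulus_off_countable
    hR h Set.countable_empty (fun z hz => ?_) (fun z hz => ?_)
  · simp at hz
    exact (hd z hz.2 hz.1).continuousAt.continuousWithinAt
  · simp at hz
    exact hd z hz.2.le hz.1.le

/-- A function holomorphic on the closed disc has no Laurent coefficients of negative index. -/
theorem laurentCoeff_eq_zero_of_differentiableAt_disc {r : ℝ} (hr : 0 < r) (m : ℕ) {F : ℂ → ℂ}
    (hF : ∀ z, ‖z‖ ≤ r → DifferentiableAt ℂ F z) : laurentCoeff r (-(m + 1 : ℕ)) F = 0 := by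
  have h : ∀ z : ℂ, z ^ (-(-((m + 1 : ℕ) : ℤ)) - 1) = z ^ m := fun z => by
    rw [← zpow_natCast]
    congr 1
    push_cast
    ring
  simp only [laurentCoeff, h]
  rw [Complex.circleIntegral_eq_zero_of_differentiable_on_off_countable hr.le
    Set.countable_empty, mul_zero]
  · intro z hz
    exact ((hF z (by simpa using hz)).mul (by fun_prop)).continuousAt.continuousWithinAt
  · intro z hz
    simp at hz
    exact (hF z hz.le).mul (by fun_prop)

theorem norm_laurentCoeff_le {r : ℝ} (hr : 0 < r) (j : ℤ) {F : ℂ → ℂ} {C : ℝ}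
    (hF : ∀ z, ‖z‖ = r → ‖F z‖ ≤ C) : ‖laurentCoeff r j F‖ ≤ C * r ^ (-j) := by
  have h := circleIntegral.norm_two_pi_i_inv_smul_integral_le_of_norm_le_const (c := 0)
    (f := fun z => F z * z ^ (-j - 1)) (C := C * r ^ (-j - 1)) hr.le (fun z hz => by
      have hz' : ‖z‖ = r := by simpa using hz
      rw [norm_mul, norm_zpow, hz']
      gcongr
      exact hF z hz')
  rw [smul_eq_mul] at h
  refine h.trans_eq ?_
  rw [zpow_sub_one₀ hr.ne']
  field_simp

end

section

open Filter Topology Complex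

/-! ### Laurent expansions of holomorphic functions -/

/-- The coefficients of a function holomorphic near the circle decay geometrically relative to
`r ^ (-j)`, as is seen by moving the contour to either side. -/
theorem summable_norm_laurentCoeff {r r₁ r₂ : ℝ} (h₁ : 0 < r₁) (h₁r : r₁ < r) (hr₂ : r < r₂)
    {F : ℂ → ℂ} (hF : ∀ z, r₁ ≤ ‖z‖ → ‖z‖ ≤ r₂ → DifferentiableAt ℂ F z) :
    Summable fun j : ℤ => ‖laurentCoeff r j F‖ * r ^ j := by
  have hr : 0 < r := h₁.trans h₁r
  have h₂ : 0 < r₂ := hr.trans hr₂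
  have bound : ∀ ρ, r₁ ≤ ρ → ρ ≤ r₂ → ∃ C, ∀ z : ℂ, ‖z‖ = ρ → ‖F z‖ ≤ C := by
    intro ρ h1 h2
    obtain ⟨C, hC⟩ := (isCompact_sphere (0 : ℂ) ρ).exists_bound_of_continuousOn (f := F)
      fun z hz => (hF z (by simp at hz; rw [hz]; exact h1)
        (by simp at hz; rw [hz]; exact h2)).continuousAt.continuousWithinAt
    exact ⟨C, fun z hz => hC z (by simpa using hz)⟩
  obtain ⟨C₁, hC₁⟩ := bound r₁ le_rfl (h₁r.trans hr₂).le
  obtain ⟨C₂, hC₂⟩ := bound r₂ (h₁r.trans hr₂).le le_rfl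
  have e₁ : ∀ j, laurentCoeff r j F = laurentCoeff r₁ j F := fun j =>
    laurentCoeff_eq_of_differentiableAt_annulus hr h₁ j fun z hz hz' =>
      hF z (by rwa [min_eq_right h₁r.le] at hz) (by rw [max_eq_left h₁r.le] at hz'; linarith)
  have e₂ : ∀ j, laurentCoeff r j F = laurentCoeff r₂ j F := fun j =>
    laurentCoeff_eq_of_differentiableAt_annulus hr h₂ j fun z hz hz' =>
      hF z (by rw [min_eq_left hr₂.le] at hz; linarith) (by rwa [max_eq_right hr₂.le] at hz')
  refine Summable.of_nat_of_neg ?_ ?_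
  · refine Summable.of_nonneg_of_le (fun n => by positivity) (fun n => ?_)
      ((summable_geometric_of_lt_one (by positivity) ((div_lt_one h₂).2 hr₂)).mul_left C₂)
    rw [e₂]
    calc _ ≤ C₂ * r₂ ^ (-(n : ℤ)) * r ^ (n : ℤ) := by
          gcongr
          exact norm_laurentCoeff_le h₂ _ hC₂
      _ = C₂ * (r / r₂) ^ n := by
          rw [zpow_neg, zpow_natCast, zpow_natCast, div_pow]
          ring
  · refine Summable.of_nonneg_of_le (fun n => by positivity) (fun n => ?_)
      ((summable_geometric_of_lt_one (by positivity) ((div_lt_one hr).2 h₁r)).mul_left C₁)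
    rw [e₁]
    calc _ ≤ C₁ * r₁ ^ (-(-(n : ℤ))) * r ^ (-(n : ℤ)) := by
          gcongr
          exact norm_laurentCoeff_le h₁ _ hC₁
      _ = C₁ * (r₁ / r) ^ n := by
          rw [neg_neg, zpow_neg, zpow_natCast, zpow_natCast, div_pow]
          ring

/-- If the coefficients are absolutely summable, the Laurent series is the Fourier series of the
function on the circle, so it converges to the function. -/
theorem hasLaurentExpansion_of_summable {r : ℝ} (hr : 0 < r) {F : ℂ → ℂ}
    (hF : ContinuousOn F (Metric.sphere 0 r))
    (hs : Summable fun j : ℤ => ‖laurentCoeff r j F‖ * r ^ j) : HasLaurentExpansion r F := by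
  have : Fact (0 < 2 * π) := ⟨Real.two_pi_pos⟩
  have hper : Function.Periodic (fun θ : ℝ => F (circleMap 0 r θ)) (2 * π) := fun θ => by
    simp [periodic_circleMap 0 r θ]
  have hcont : Continuous (fun θ : ℝ => F (circleMap 0 r θ)) :=
    hF.comp_continuous (continuous_circleMap 0 r) fun θ => circleMap_mem_sphere 0 hr.le θ
  let f : C(AddCircle (2 * π), ℂ) := ⟨hper.lift, continuous_coinduced_dom.2 hcont⟩
  have hpow : ∀ (j : ℤ) (θ : ℝ), (circleMap 0 r θ) ^ j = (r : ℂ) ^ j * exp (j * θ * I) := by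
    intro j θ
    rw [circleMap_zero, mul_zpow, ← Complex.exp_int_mul, mul_assoc]
  have hfour : ∀ (j : ℤ) (θ : ℝ), fourier j (θ : AddCircle (2 * π)) = exp (j * θ * I) := by
    intro j θ
    rw [fourier_coe_apply]
    congr 1
    have : (π : ℂ) ≠ 0 := by exact_mod_cast Real.pi_ne_zero
    push_cast
    field_simp
  have hcoef : ∀ j : ℤ, fourierCoeff f j = laurentCoeff r j F * (r : ℂ) ^ j := by
    intro j
    rw [fourierCoeff_eq_intervalIntegral f j 0, laurentCoeff_eq_circleAverage hr,
      Real.circleAverage_def, smul_mul_assoc, ← intervalIntegral.integral_mul_const, zero_add,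
      one_div]
    congr 2
    ext θ
    rw [hfour, hpow]
    have h : f (θ : AddCircle (2 * π)) = F (circleMap 0 r θ) := rfl
    have hr' : (r : ℂ) ≠ 0 := by exact_mod_cast hr.ne'
    have hinv : (r : ℂ) ^ j * (r : ℂ) ^ (-j) = 1 := by
      rw [← zpow_add₀ hr', add_neg_cancel, zpow_zero]
    rw [h, smul_eq_mul]
    linear_combination -(F (circleMap 0 r θ) * exp ((-j : ℤ) * θ * I)) * hinv
  have hsum : Summable (fourierCoeff f) := by
    refine Summable.of_norm (hs.congr fun j => ?_)
    rw [hcoef, norm_mul, norm_zpow, norm_real, Real.norm_of_nonneg hr.le]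
  intro z hz
  have hzc : circleMap 0 r z.arg = z := by
    rw [circleMap_zero, ← hz, norm_mul_exp_arg_mul_I]
  have h := has_pointwise_sum_fourier_series_of_summable hsum (z.arg : AddCircle (2 * π))
  have hfz : f (z.arg : AddCircle (2 * π)) = F z := by
    change F (circleMap 0 r z.arg) = F z
    rw [hzc]
  rw [hfz] at h
  refine h.congr_fun fun j => ?_
  rw [hcoef, hfour, smul_eq_mul, mul_assoc, ← hpow, hzc]

theorem hasLaurentExpansion_of_differentiableAt {r : ℝ} (hr : 0 < r) {F : ℂ → ℂ}
    (hF : ∀ z, ‖z‖ = r → ∀ᶠ w in 𝓝 z, DifferentiableAt ℂ F w) : HasLaurentExpansion r F := by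
  -- By compactness the function is holomorphic on a closed annulus around the circle.
  set U := {z | ∀ᶠ w in 𝓝 z, DifferentiableAt ℂ F w}
  have hU : IsOpen U := isOpen_setOfPred_eventually_nhds
  obtain ⟨δ, hδ, hsub⟩ := (isCompact_sphere (0 : ℂ) r).exists_cthickening_subset_open hU
    fun z hz => hF z (by simpa using hz)
  set ε := min δ (r / 2)
  have hε : 0 < ε := lt_min hδ (by linarith)
  have hεr : ε ≤ r / 2 := min_le_right _ _
  have hεδ : ε ≤ δ := min_le_left _ _
  have hd : ∀ z : ℂ, r - ε ≤ ‖z‖ → ‖z‖ ≤ r + ε → DifferentiableAt ℂ F z := by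
    intro z h1 h2
    have hz : 0 < ‖z‖ := by linarith
    have hmem : z ∈ Metric.cthickening δ (Metric.sphere (0 : ℂ) r) := by
      refine Metric.mem_cthickening_of_dist_le z ((r / ‖z‖ : ℝ) * z) δ _ ?_ ?_
      · simp [abs_of_pos hr, hz.ne']
      · have h : z - (r / ‖z‖ : ℝ) * z = ((‖z‖ - r) / ‖z‖ : ℝ) * z := by
          have : (‖z‖ : ℂ) ≠ 0 := by exact_mod_cast hz.ne'
          push_cast
          field_simp
        rw [dist_eq_norm, h, norm_mul, norm_real, norm_div, norm_norm,
          div_mul_cancel₀ _ hz.ne', Real.norm_eq_abs, abs_le]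
        constructor <;> linarith
    exact (hsub hmem).self_of_nhds
  exact hasLaurentExpansion_of_summable hr
    (fun z hz => (hF z (by simpa using hz)).self_of_nhds.continuousAt.continuousWithinAt)
    (summable_norm_laurentCoeff (r₁ := r - ε) (r₂ := r + ε) (by linarith) (by linarith)
      (by linarith) hd)

end

section

open Filter Topology Complex

/-! ### Theta quotients with four parameters -/

/-- The function
`(aqz², 1/(az²);q)_∞ / (cz, dz, e/(az), f/(az);q)_∞`. -/
noncomputable def thetaQuot (a c d e f q z : ℂ) : ℂ :=
  (qPochInf (a * q * z ^ 2) q * qPochInf (1 / (a * z ^ 2)) q) /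
    (qPochInf (c * z) q * qPochInf (d * z) q *
      (qPochInf (e / (a * z)) q * qPochInf (f / (a * z)) q))

/-- The circle `|z| = ρ` lies in the annulus on which every factor of the denominator of
`thetaQuot a c d e f q` is visibly nonzero. -/
structure InAnnulus (a c d e f : ℂ) (ρ : ℝ) : Prop where
  pos : 0 < ρ
  c_lt : ‖c‖ * ρ < 1
  d_lt : ‖d‖ * ρ < 1
  e_lt : ‖e‖ < ‖a‖ * ρ
  f_lt : ‖f‖ < ‖a‖ * ρ

namespace InAnnulus

variable {a c d e f q : ℂ} {r ρ : ℝ}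

theorem a_ne_zero (h : InAnnulus a c d e f r) : a ≠ 0 := by
  rintro rfl
  have h1 := h.e_lt
  rw [norm_zero, zero_mul] at h1
  exact absurd h1 (norm_nonneg e).not_gt

theorem between (h : InAnnulus a c d e f r) (h' : InAnnulus a c d e f ρ) {t : ℝ}
    (h₁ : min r ρ ≤ t) (h₂ : t ≤ max r ρ) : InAnnulus a c d e f t := by
  wlog hle : r ≤ ρ generalizing r ρ
  · exact this h' h (by rwa [min_comm]) (by rwa [max_comm]) (le_of_not_ge hle)
  rw [min_eq_left hle] at h₁
  rw [max_eq_right hle] at h₂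
  exact ⟨h.pos.trans_le h₁,
    (mul_le_mul_of_nonneg_left h₂ (norm_nonneg _)).trans_lt h'.c_lt,
    (mul_le_mul_of_nonneg_left h₂ (norm_nonneg _)).trans_lt h'.d_lt,
    h.e_lt.trans_le (mul_le_mul_of_nonneg_left h₁ (norm_nonneg _)),
    h.f_lt.trans_le (mul_le_mul_of_nonneg_left h₁ (norm_nonneg _))⟩

theorem swap (h : InAnnulus a c d e f r) : InAnnulus a d c f e r :=
  ⟨h.pos, h.d_lt, h.c_lt, h.f_lt, h.e_lt⟩

theorem mono {c' d' e' f' : ℂ} (h : InAnnulus a c d e f r) (hc : ‖c'‖ ≤ ‖c‖) (hd : ‖d'‖ ≤ ‖d‖)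
    (he : ‖e'‖ ≤ ‖e‖) (hf : ‖f'‖ ≤ ‖f‖) : InAnnulus a c' d' e' f' r :=
  ⟨h.pos, (mul_le_mul_of_nonneg_right hc h.pos.le).trans_lt h.c_lt,
    (mul_le_mul_of_nonneg_right hd h.pos.le).trans_lt h.d_lt,
    he.trans_lt h.e_lt, hf.trans_lt h.f_lt⟩

theorem reflect (h : InAnnulus a c d e f r) : InAnnulus a e f c d (‖a‖ * r)⁻¹ := by
  have ha : 0 < ‖a‖ := norm_pos_iff.2 h.a_ne_zero
  have hr := h.pos
  have har : 0 < ‖a‖ * r := by positivity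
  have e1 : ‖a‖ * (‖a‖ * r)⁻¹ = r⁻¹ := by field_simp
  refine ⟨by positivity, ?_, ?_, ?_, ?_⟩
  · rw [← div_eq_mul_inv, div_lt_one har]; exact h.e_lt
  · rw [← div_eq_mul_inv, div_lt_one har]; exact h.f_lt
  · rw [e1, ← one_div, lt_div_iff₀ hr]; exact h.c_lt
  · rw [e1, ← one_div, lt_div_iff₀ hr]; exact h.d_lt

/-- The parameters attached to `z⁻¹` may be multiplied by `q` if the radius is. -/
theorem shrink (h : InAnnulus a c d e f r) (hq : ‖q‖ < 1) (hq0 : q ≠ 0) :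
    InAnnulus a c d (e * q) (f * q) (‖q‖ * r) := by
  have hqp : 0 < ‖q‖ := norm_pos_iff.2 hq0
  have hr := h.pos
  have hle : ‖q‖ * r ≤ r := mul_le_of_le_one_left hr.le hq.le
  refine ⟨by positivity, (mul_le_mul_of_nonneg_left hle (norm_nonneg _)).trans_lt h.c_lt,
    (mul_le_mul_of_nonneg_left hle (norm_nonneg _)).trans_lt h.d_lt, ?_, ?_⟩
  · rw [norm_mul, mul_comm ‖q‖ r, ← mul_assoc]
    exact mul_lt_mul_of_pos_right h.e_lt hqp
  · rw [norm_mul, mul_comm ‖q‖ r, ← mul_assoc]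
    exact mul_lt_mul_of_pos_right h.f_lt hqp

theorem norm_div_lt (h : InAnnulus a c d e f ρ) {z : ℂ} (hz : ‖z‖ = ρ) : ‖e / (a * z)‖ < 1 := by
  have ha : 0 < ‖a‖ := norm_pos_iff.2 h.a_ne_zero
  rw [norm_div, norm_mul, hz, div_lt_one (mul_pos ha h.pos)]
  exact h.e_lt

theorem norm_mul_lt (h : InAnnulus a c d e f ρ) {z : ℂ} (hz : ‖z‖ = ρ) : ‖c * z‖ < 1 := by
  rw [norm_mul, hz]
  exact h.c_lt

theorem denom_ne_zero (hq : ‖q‖ < 1) (h : InAnnulus a c d e f ρ) {z : ℂ} (hz : ‖z‖ = ρ) :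
    qPochInf (c * z) q * qPochInf (d * z) q *
      (qPochInf (e / (a * z)) q * qPochInf (f / (a * z)) q) ≠ 0 :=
  mul_ne_zero (mul_ne_zero (qPochInf_ne_zero hq (h.norm_mul_lt hz))
      (qPochInf_ne_zero hq (h.swap.norm_mul_lt hz)))
    (mul_ne_zero (qPochInf_ne_zero hq (h.norm_div_lt hz))
      (qPochInf_ne_zero hq (h.swap.norm_div_lt hz)))

theorem differentiableAt (hq : ‖q‖ < 1) {z : ℂ} (h : InAnnulus a c d e f ‖z‖) :
    DifferentiableAt ℂ (thetaQuot a c d e f q) z := by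
  have hz : z ≠ 0 := norm_pos_iff.1 h.pos
  have ha := h.a_ne_zero
  have hd := differentiable_qPochInf hq
  have key : ∀ g : ℂ → ℂ, DifferentiableAt ℂ g z →
      DifferentiableAt ℂ (fun w => qPochInf (g w) q) z := fun g hg => (hd (g z)).comp z hg
  have hne : a * z ≠ 0 := mul_ne_zero ha hz
  have hne2 : a * z ^ 2 ≠ 0 := mul_ne_zero ha (pow_ne_zero 2 hz)
  unfold thetaQuot
  refine DifferentiableAt.fun_div
    ((key _ (by fun_prop)).fun_mul (key _ (by fun_prop (disch := assumption))))
    (((key _ (by fun_prop)).fun_mul (key _ (by fun_prop))).fun_mul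
      ((key _ (by fun_prop (disch := assumption))).fun_mul
        (key _ (by fun_prop (disch := assumption)))))
    (h.denom_ne_zero hq rfl)

theorem continuousOn (hq : ‖q‖ < 1) (h : InAnnulus a c d e f ρ) :
    ContinuousOn (thetaQuot a c d e f q) (Metric.sphere 0 ρ) := fun z hz => by
  have hz' : ‖z‖ = ρ := by simpa using hz
  exact (differentiableAt hq (hz' ▸ h)).continuousAt.continuousWithinAt

/-- The Laurent coefficients do not depend on the circle chosen in the annulus. -/
theorem laurentCoeff_eq (hq : ‖q‖ < 1) (h : InAnnulus a c d e f r) (h' : InAnnulus a c d e f ρ)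
    (j : ℤ) : laurentCoeff r j (thetaQuot a c d e f q) = laurentCoeff ρ j (thetaQuot a c d e f q) :=
  laurentCoeff_eq_of_differentiableAt_annulus h.pos h'.pos j fun _ h₁ h₂ =>
    differentiableAt hq (h.between h' h₁ h₂)

end InAnnulus

theorem thetaQuot_swap (a c d e f q : ℂ) : thetaQuot a c d e f q = thetaQuot a d c f e q := by
  ext z
  simp only [thetaQuot]
  ring

variable {a c d e f q : ℂ} {r : ℝ}

theorem thetaQuot_mul_q_left (hq : ‖q‖ < 1) (h : InAnnulus a c d e f r) {z : ℂ} (hz : ‖z‖ = r) :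
    thetaQuot a (c * q) d e f q z = (1 - c * z) * thetaQuot a c d e f q z := by
  have hc := h.norm_mul_lt hz
  have h1 : 1 - c * z ≠ 0 := fun h0 => by
    have : c * z = 1 := by linear_combination -h0
    rw [this] at hc
    simp at hc
  rw [thetaQuot, thetaQuot, qPochInf_eq_one_sub_mul hq (c * z), mul_right_comm c z q,
    ← mul_div_assoc,
    mul_assoc (1 - c * z), mul_assoc (1 - c * z), mul_div_mul_left _ _ h1]

theorem thetaQuot_mul_q_right (hq : ‖q‖ < 1) (h : InAnnulus a c d e f r) {z : ℂ} (hz : ‖z‖ = r) :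
    thetaQuot a c d (e * q) f q z = (1 - e / (a * z)) * thetaQuot a c d e f q z := by
  have hc := h.norm_div_lt hz
  have h1 : 1 - e / (a * z) ≠ 0 := fun h0 => by
    have : e / (a * z) = 1 := by linear_combination -h0
    rw [this] at hc
    simp at hc
  rw [thetaQuot, thetaQuot, qPochInf_eq_one_sub_mul hq (e / (a * z)), div_mul_eq_mul_div e,
    ← mul_div_assoc, mul_assoc (1 - e / (a * z)), mul_left_comm _ (1 - e / (a * z)),
    mul_div_mul_left _ _ h1]

/-- The symmetry of the theta quotient under `z ↦ 1/(az)`. -/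
theorem thetaQuot_reflect (hq : ‖q‖ < 1) (ha : a ≠ 0) {z : ℂ} (hz : z ≠ 0) :
    thetaQuot a e f c d q (a * z)⁻¹ = -(a * z ^ 2) * thetaQuot a c d e f q z := by
  have e1 : a * q * (a * z)⁻¹ ^ 2 = 1 / (a * z ^ 2) * q := by field_simp
  have e2 : 1 / (a * (a * z)⁻¹ ^ 2) = a * z ^ 2 := by field_simp
  have e3 : ∀ x : ℂ, x / (a * (a * z)⁻¹) = x * z := fun x => by field_simp
  rw [thetaQuot, thetaQuot, e1, e2, e3, e3, ← div_eq_mul_inv, ← div_eq_mul_inv,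
    qPochInf_eq_one_sub_mul hq (a * z ^ 2), qPochInf_eq_one_sub_mul hq (1 / (a * z ^ 2)),
    mul_right_comm a (z ^ 2) q, mul_comm (qPochInf (c * z) q * _)]
  rw [← mul_div_assoc]
  congr 1
  field_simp
  ring

/-- The `q`-difference equation of the theta quotient. Because `e` and `f` carry a factor `q` on the
right, no point `qz` with `z` in the annulus of the left-hand side is a pole. -/
theorem thetaQuot_qshift (hq : ‖q‖ < 1) (hq0 : q ≠ 0) (ha : a ≠ 0) {z : ℂ} (hz : z ≠ 0) :
    thetaQuot a (c * q) (d * q) e f q z =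
      a ^ 2 * q ^ 3 * (z ^ 4 * thetaQuot a c d (e * q) (f * q) q (q * z)) := by
  have e1 : a * q * (q * z) ^ 2 = a * q * z ^ 2 * q * q := by ring
  have e2 : 1 / (a * (q * z) ^ 2) * q * q = 1 / (a * z ^ 2) := by field_simp
  have e3 : ∀ x : ℂ, x * q / (a * (q * z)) = x / (a * z) := fun x => by field_simp
  rw [thetaQuot, thetaQuot, e1, e3, e3, ← mul_assoc c, ← mul_assoc d,
    qPochInf_eq_one_sub_mul hq (a * q * z ^ 2), qPochInf_eq_one_sub_mul hq (a * q * z ^ 2 * q),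
    qPochInf_eq_one_sub_mul hq (1 / (a * (q * z) ^ 2)),
    qPochInf_eq_one_sub_mul hq (1 / (a * (q * z) ^ 2) * q), e2]
  rw [← mul_div_assoc, ← mul_div_assoc]
  congr 1
  field_simp
  ring

/-! ### Relations between the coefficients of theta quotients -/

theorem laurentCoeff_one_sub_mul (hr : 0 < r) (j : ℤ) (c : ℂ) {F : ℂ → ℂ}
    (hF : ContinuousOn F (Metric.sphere 0 r)) :
    laurentCoeff r j (fun z => (1 - c * z) * F z) =
      laurentCoeff r j F - c * laurentCoeff r (j - 1) F := by
  have h : laurentCoeff r j (fun z => (1 - c * z) * F z) =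
      laurentCoeff r j (fun z => F z + -c * (z ^ (1 : ℤ) * F z)) := by
    congr 1
    ext z
    rw [zpow_one]
    ring
  have hc : ContinuousOn (fun z : ℂ => -c * (z ^ (1 : ℤ) * F z)) (Metric.sphere 0 r) := by
    simp only [zpow_one]
    fun_prop
  rw [h, laurentCoeff_add hr j hF hc, laurentCoeff_const_mul, laurentCoeff_zpow_mul hr]
  ring

theorem laurentCoeff_one_sub_div (hr : 0 < r) (j : ℤ) (a e : ℂ) {F : ℂ → ℂ}
    (hF : ContinuousOn F (Metric.sphere 0 r)) :
    laurentCoeff r j (fun z => (1 - e / (a * z)) * F z) =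
      laurentCoeff r j F - e / a * laurentCoeff r (j + 1) F := by
  have h : laurentCoeff r j (fun z => (1 - e / (a * z)) * F z) =
      laurentCoeff r j (fun z => F z + -(e / a) * (z ^ (-1 : ℤ) * F z)) := by
    congr 1
    ext z
    rw [zpow_neg_one, ← div_div]
    ring
  have hc : ContinuousOn (fun z : ℂ => -(e / a) * (z ^ (-1 : ℤ) * F z)) (Metric.sphere 0 r) := by
    simp only [zpow_neg_one]
    exact continuousOn_const.mul ((continuousOn_id.inv₀ fun z hz =>
      ne_zero_of_norm_eq hr (by simpa using hz)).mul hF)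
  rw [h, laurentCoeff_add hr j hF hc, laurentCoeff_const_mul, laurentCoeff_zpow_mul hr]
  ring_nf

theorem laurentCoeff_thetaQuot_mul_q_left (hq : ‖q‖ < 1) (h : InAnnulus a c d e f r) (j : ℤ) :
    laurentCoeff r j (thetaQuot a (c * q) d e f q) =
      laurentCoeff r j (thetaQuot a c d e f q) -
        c * laurentCoeff r (j - 1) (thetaQuot a c d e f q) := by
  rw [laurentCoeff_congr h.pos j fun z hz => thetaQuot_mul_q_left hq h hz]
  exact laurentCoeff_one_sub_mul h.pos j c (h.continuousOn hq)

theorem laurentCoeff_thetaQuot_mul_q_right (hq : ‖q‖ < 1) (h : InAnnulus a c d e f r) (j : ℤ) :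
    laurentCoeff r j (thetaQuot a c d (e * q) f q) =
      laurentCoeff r j (thetaQuot a c d e f q) -
        e / a * laurentCoeff r (j + 1) (thetaQuot a c d e f q) := by
  rw [laurentCoeff_congr h.pos j fun z hz => thetaQuot_mul_q_right hq h hz]
  exact laurentCoeff_one_sub_div h.pos j a e (h.continuousOn hq)

theorem norm_mul_q_le (hq : ‖q‖ < 1) (x : ℂ) : ‖x * q‖ ≤ ‖x‖ := by
  rw [norm_mul]
  exact mul_le_of_le_one_right (norm_nonneg _) hq.le

theorem laurentCoeff_thetaQuot_mul_q_left₂ (hq : ‖q‖ < 1) (h : InAnnulus a c d e f r) (j : ℤ) :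
    laurentCoeff r j (thetaQuot a (c * q) (d * q) e f q) =
      laurentCoeff r j (thetaQuot a c d e f q) -
        (c + d) * laurentCoeff r (j - 1) (thetaQuot a c d e f q) +
        c * d * laurentCoeff r (j - 2) (thetaQuot a c d e f q) := by
  have h' : InAnnulus a c (d * q) e f r := h.mono le_rfl (norm_mul_q_le hq d) le_rfl le_rfl
  have hd : ∀ i, laurentCoeff r i (thetaQuot a c (d * q) e f q) =
      laurentCoeff r i (thetaQuot a c d e f q) -
        d * laurentCoeff r (i - 1) (thetaQuot a c d e f q) := fun i => by
    rw [thetaQuot_swap, laurentCoeff_thetaQuot_mul_q_left hq h.swap, thetaQuot_swap]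
  rw [laurentCoeff_thetaQuot_mul_q_left hq h', hd, hd, sub_sub j]
  norm_num
  ring

theorem laurentCoeff_thetaQuot_mul_q_right₂ (hq : ‖q‖ < 1) (h : InAnnulus a c d e f r) (j : ℤ) :
    laurentCoeff r j (thetaQuot a c d (e * q) (f * q) q) =
      laurentCoeff r j (thetaQuot a c d e f q) -
        (e + f) / a * laurentCoeff r (j + 1) (thetaQuot a c d e f q) +
        e * f / a ^ 2 * laurentCoeff r (j + 2) (thetaQuot a c d e f q) := by
  have h' : InAnnulus a c d e (f * q) r := h.mono le_rfl le_rfl le_rfl (norm_mul_q_le hq f)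
  have hd : ∀ i, laurentCoeff r i (thetaQuot a c d e (f * q) q) =
      laurentCoeff r i (thetaQuot a c d e f q) -
        f / a * laurentCoeff r (i + 1) (thetaQuot a c d e f q) := fun i => by
    rw [thetaQuot_swap, laurentCoeff_thetaQuot_mul_q_right hq h.swap, thetaQuot_swap]
  rw [laurentCoeff_thetaQuot_mul_q_right hq h', hd, hd, add_assoc j]
  norm_num
  ring

/-- The reflection `z ↦ 1/(az)` relates the coefficients on two circles that it interchanges. -/
theorem laurentCoeff_thetaQuot_reflect (hq : ‖q‖ < 1) (h : InAnnulus a c d e f r) (j : ℤ) :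
    a ^ j * laurentCoeff (‖a‖ * r)⁻¹ (-j) (thetaQuot a e f c d q) =
      -a * laurentCoeff r (j - 2) (thetaQuot a c d e f q) := by
  have ha := h.a_ne_zero
  have hpos : 0 < ‖a‖ * r := mul_pos (norm_pos_iff.2 ha) h.pos
  rw [← laurentCoeff_comp_inv hpos,
    ← laurentCoeff_comp_mul_left h.pos j ha (fun z => thetaQuot a e f c d q z⁻¹),
    ← laurentCoeff_zpow_mul h.pos, ← laurentCoeff_const_mul]
  refine laurentCoeff_congr h.pos j fun z hz => ?_
  rw [thetaQuot_reflect hq ha (ne_zero_of_norm_eq h.pos hz), zpow_ofNat]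
  ring

/-- For `q = e = f = 0` the theta quotient is `z⁻²` times a function holomorphic on the disc. -/
theorem laurentCoeff_thetaQuot_q_zero (h : InAnnulus a c d e f r) (k : ℕ) :
    laurentCoeff r (-(k + 3 : ℕ)) (thetaQuot a c d 0 0 0) = 0 := by
  have h1 : laurentCoeff r (-(k + 3 : ℕ)) (thetaQuot a c d 0 0 0) =
      laurentCoeff r (-(k + 3 : ℕ))
        (fun z => z ^ (-2 : ℤ) * ((z ^ 2 - 1 / a) / ((1 - c * z) * (1 - d * z)))) := by
    refine laurentCoeff_congr h.pos _ fun z hz => ?_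
    have hz0 := ne_zero_of_norm_eq h.pos hz
    have ha := h.a_ne_zero
    simp only [thetaQuot, qPochInf_zero_right]
    rw [zpow_neg, ← mul_div_assoc]
    simp only [zero_div, mul_zero, zero_mul, sub_zero, mul_one, one_mul]
    congr 1
    rw [zpow_ofNat]
    field_simp
  have h2 : (-((k + 3 : ℕ) : ℤ) - -2) = -((k + 1 : ℕ) : ℤ) := by
    push_cast
    ring
  rw [h1, laurentCoeff_zpow_mul h.pos, h2]
  refine laurentCoeff_eq_zero_of_differentiableAt_disc h.pos k fun z hz => ?_
  have hne : ∀ x : ℂ, ‖x‖ * r < 1 → 1 - x * z ≠ 0 := fun x hx h0 => by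
    have h3 : x * z = 1 := by linear_combination -h0
    have h4 : ‖x * z‖ < 1 := by
      rw [norm_mul]
      exact (mul_le_mul_of_nonneg_left hz (norm_nonneg _)).trans_lt hx
    rw [h3] at h4
    simp at h4
  exact DifferentiableAt.fun_div (by fun_prop) (by fun_prop)
    (mul_ne_zero (hne c h.c_lt) (hne d h.d_lt))

/-- The `q`-difference equation, read off coefficientwise. -/
theorem laurentCoeff_thetaQuot_qshift (hq : ‖q‖ < 1) (h : InAnnulus a c d e f r) (m : ℕ) :
    laurentCoeff r (m + 1) (thetaQuot a (c * q) (d * q) e f q) =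
      a ^ 2 * q ^ m * laurentCoeff r (m - 3) (thetaQuot a c d (e * q) (f * q) q) := by
  have ha := h.a_ne_zero
  by_cases hq0 : q = 0
  · -- For `q = 0` both sides vanish: on the left there are no positive powers of `z`,
    -- and the right-hand side is nontrivial only for `m = 0`.
    subst hq0
    simp only [mul_zero]
    have hl : laurentCoeff r (m + 1) (thetaQuot a 0 0 e f 0) = 0 := by
      have h0 : InAnnulus a 0 0 e f r :=
        h.mono (by simp) (by simp) le_rfl le_rfl
      have := laurentCoeff_thetaQuot_reflect (q := 0) (by simp) h0 (m + 3)
      have h3 : -((m : ℤ) + 3) = -((m + 3 : ℕ) : ℤ) := by push_cast; ring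
      rw [h3, laurentCoeff_thetaQuot_q_zero h0.reflect, mul_zero,
        show (m : ℤ) + 3 - 2 = m + 1 by ring] at this
      simpa [ha] using this.symm
    rw [hl]
    rcases m with _ | m
    · have := laurentCoeff_thetaQuot_q_zero h 0
      simp only [Nat.cast_zero, zero_sub]
      simp only [zero_add, Nat.cast_ofNat] at this
      rw [this, mul_zero]
    · simp
  · have hcd : InAnnulus a c d (e * q) (f * q) r :=
      h.mono le_rfl le_rfl (norm_mul_q_le hq e) (norm_mul_q_le hq f)
    rw [hcd.laurentCoeff_eq hq (h.shrink hq hq0),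
      laurentCoeff_congr h.pos _ fun z hz =>
        thetaQuot_qshift hq hq0 ha (ne_zero_of_norm_eq h.pos hz)]
    have h4 : ∀ z : ℂ, z ^ 4 = z ^ (4 : ℤ) := fun z => by rw [zpow_ofNat]
    simp only [h4]
    rw [laurentCoeff_const_mul, laurentCoeff_zpow_mul h.pos,
      laurentCoeff_comp_mul_left h.pos _ hq0 (thetaQuot a c d (e * q) (f * q) q),
      show (m : ℤ) + 1 - 4 = m - 3 by ring, zpow_sub₀ hq0, zpow_natCast, zpow_ofNat]
    field_simp

/-- The recurrence of the Laurent coefficients of a theta quotient. -/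
theorem laurentCoeff_thetaQuot_recurrence (hq : ‖q‖ < 1) (h : InAnnulus a c d e f r) (m : ℕ) :
    laurentCoeff r (m + 1) (thetaQuot a c d e f q) -
        (c + d) * laurentCoeff r m (thetaQuot a c d e f q) +
        c * d * laurentCoeff r (m - 1) (thetaQuot a c d e f q) =
      q ^ m * (a ^ 2 * laurentCoeff r (m - 3) (thetaQuot a c d e f q) -
        a * (e + f) * laurentCoeff r (m - 2) (thetaQuot a c d e f q) +
        e * f * laurentCoeff r (m - 1) (thetaQuot a c d e f q)) := by
  have h1 := laurentCoeff_thetaQuot_qshift hq h m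
  have ha := h.a_ne_zero
  rw [laurentCoeff_thetaQuot_mul_q_left₂ hq h, laurentCoeff_thetaQuot_mul_q_right₂ hq h,
    show (m : ℤ) + 1 - 1 = m by ring, show (m : ℤ) + 1 - 2 = m - 1 by ring,
    show (m : ℤ) - 3 + 1 = m - 2 by ring, show (m : ℤ) - 3 + 2 = m - 1 by ring] at h1
  rw [h1]
  field_simp

end

section

open Filter Topology Complex

variable {a c d e f q : ℂ} {r : ℝ}

/-! ### Evaluation of constant terms -/

theorem norm_qPoch_le (hq : ‖q‖ < 1) (z : ℂ) (n : ℕ) :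
    ‖qPoch z q n‖ ≤ Real.exp (‖z‖ / (1 - ‖q‖)) := by
  rw [qPoch, norm_prod]
  calc ∏ i ∈ Finset.range n, ‖1 - z * q ^ i‖
      ≤ ∏ i ∈ Finset.range n, Real.exp (‖z‖ * ‖q‖ ^ i) := by
        refine Finset.prod_le_prod (fun i _ => norm_nonneg _) fun i _ => ?_
        calc ‖1 - z * q ^ i‖ ≤ 1 + ‖z‖ * ‖q‖ ^ i := by
              simpa using norm_sub_le (1 : ℂ) (z * q ^ i)
          _ ≤ _ := by
              rw [add_comm]
              exact Real.add_one_le_exp _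
    _ = Real.exp (∑ i ∈ Finset.range n, ‖z‖ * ‖q‖ ^ i) := (Real.exp_sum _ _).symm
    _ ≤ _ := by
        rw [← Finset.mul_sum, div_eq_mul_inv, ← tsum_geometric_of_lt_one (norm_nonneg _) hq]
        gcongr
        exact (summable_geometric_of_lt_one (norm_nonneg _) hq).sum_le_tsum _
          fun i _ => by positivity

theorem tendsto_laurentCoeff (hr : 0 < r) (j : ℤ) {F : ℕ → ℂ → ℂ} {G : ℂ → ℂ} {C : ℝ}
    (hF : ∀ N, ContinuousOn (F N) (Metric.sphere 0 r)) (hC : ∀ N z, ‖z‖ = r → ‖F N z‖ ≤ C)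
    (hG : ∀ z, ‖z‖ = r → Tendsto (fun N => F N z) atTop (𝓝 (G z))) :
    Tendsto (fun N => laurentCoeff r j (F N)) atTop (𝓝 (laurentCoeff r j G)) := by
  simp only [laurentCoeff_eq_circleAverage hr, Real.circleAverage_def]
  have hn : ∀ θ, ‖circleMap 0 r θ‖ = r := fun θ => by simp [abs_of_pos hr]
  refine Tendsto.const_smul (intervalIntegral.tendsto_integral_filter_of_dominated_convergence
    (fun _ => C * r ^ (-j)) (Eventually.of_forall fun N => ?_)
    (Eventually.of_forall fun N => MeasureTheory.ae_of_all _ fun θ _ => ?_) (by simp)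
    (MeasureTheory.ae_of_all _ fun θ _ => (hG _ (hn θ)).mul_const _)) _
  · rw [Set.uIoc_of_le Real.two_pi_pos.le]
    exact (circleIntegrable_mul_zpow hr (-j) (hF N)).1.aestronglyMeasurable
  · rw [norm_mul, norm_zpow, hn]
    gcongr
    exact hC N _ (hn θ)

/-- The constant term of `(qy;q)_m (1/y;q)_∞`, with `y = az²`, is `1/(q;q)_m`. -/
theorem laurentCoeff_qPoch_mul_qPochInf (hq : ‖q‖ < 1) (ha : a ≠ 0) (hr : 0 < r) (m : ℕ) :
    laurentCoeff r 0 (fun z => qPoch (a * q * z ^ 2) q m * qPochInf (1 / (a * z ^ 2)) q) *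
      qPoch q q m = 1 := by
  set g : ℕ → ℂ → ℂ := fun m z => qPoch (a * q * z ^ 2) q m * qPochInf (1 / (a * z ^ 2)) q with hg
  have hdiff : ∀ m, ∀ z : ℂ, z ≠ 0 → DifferentiableAt ℂ (g m) z := fun m z hz => by
    have hne : a * z ^ 2 ≠ 0 := mul_ne_zero ha (pow_ne_zero 2 hz)
    refine DifferentiableAt.fun_mul
      ((differentiable_qPoch q m _).comp z (f := fun z => a * q * z ^ 2) (by fun_prop)) ?_
    exact (differentiable_qPochInf hq _).comp z (f := fun z => 1 / (a * z ^ 2))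
      (by fun_prop (disch := assumption))
  have hcont : ∀ m, ContinuousOn (g m) (Metric.sphere 0 r) := fun m z hz =>
    (hdiff m z (ne_zero_of_norm_eq hr (by simpa using hz))).continuousAt.continuousWithinAt
  -- The function `(1/y;q)_∞` is holomorphic at infinity.
  have base : laurentCoeff r 0 (g 0) = 1 := by
    have h : laurentCoeff r 0 (g 0) =
        laurentCoeff r 0 (fun z => (fun w => qPochInf (w ^ 2 / a) q) z⁻¹) := by
      refine laurentCoeff_congr hr _ fun z hz => ?_
      simp only [hg, qPoch, Finset.range_zero, Finset.prod_empty, one_mul]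
      congr 1
      rw [inv_pow, div_eq_mul_inv, mul_inv, one_mul, mul_comm, ← div_eq_mul_inv]
    rw [h, laurentCoeff_comp_inv hr 0 fun w => qPochInf (w ^ 2 / a) q,
      laurentCoeff_eq_circleAverage (inv_pos.2 hr)]
    have hd : Differentiable ℂ fun w : ℂ => qPochInf (w ^ 2 / a) q :=
      (differentiable_qPochInf hq).comp (g := fun z => qPochInf z q) (f := fun w => w ^ 2 / a)
        (by fun_prop)
    simp only [neg_zero, zpow_zero, mul_one]
    rw [circleAverage_of_differentiable_on_off_countable Set.countable_empty
      hd.continuous.continuousOn fun z _ => hd z]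
    simp [qPochInf_zero_left]
  have step : ∀ m, laurentCoeff r 0 (g (m + 1)) * (1 - q * q ^ m) = laurentCoeff r 0 (g m) := by
    intro m
    have h1 : laurentCoeff r 0 (g (m + 1)) =
        laurentCoeff r 0 (g m) - a * q ^ (m + 1) * laurentCoeff r (-2) (g m) := by
      have : g (m + 1) = fun z => g m z + -(a * q ^ (m + 1)) * (z ^ (2 : ℤ) * g m z) := by
        ext z
        simp only [hg, qPoch_succ, zpow_ofNat]
        ring
      have hc : ContinuousOn (fun z => -(a * q ^ (m + 1)) * (z ^ (2 : ℤ) * g m z))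
          (Metric.sphere 0 r) := by
        simp only [zpow_ofNat]
        exact continuousOn_const.mul ((continuousOn_pow 2).mul (hcont m))
      rw [this, laurentCoeff_add hr _ (hcont m) hc, laurentCoeff_const_mul,
        laurentCoeff_zpow_mul hr]
      ring_nf
    by_cases hq0 : q = 0
    · subst hq0
      rw [h1]
      simp
    · obtain ⟨s, hs⟩ := IsAlgClosed.exists_pow_nat_eq q (n := 2) two_pos
      have hs0 : s ≠ 0 := by
        rintro rfl
        exact hq0 (by simpa using hs.symm)
      have hsr : 0 < ‖s‖ * r := mul_pos (norm_pos_iff.2 hs0) hr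
      -- Replacing `z` by `sz` replaces `y` by `qy`.
      have h2 : laurentCoeff r (-2) (fun z => g m (s * z)) =
          s ^ (-2 : ℤ) * laurentCoeff r (-2) (g m) := by
        rw [laurentCoeff_comp_mul_left hr _ hs0]
        congr 1
        exact laurentCoeff_eq_of_differentiableAt_annulus hsr hr _ fun z hz _ =>
          hdiff m z (norm_pos_iff.1 ((lt_min hsr hr).trans_le hz))
      have h3 : laurentCoeff r 0 (fun z => a * q * (z ^ (2 : ℤ) * g m (s * z))) =
          -laurentCoeff r 0 (g (m + 1)) := by
        rw [neg_eq_neg_one_mul, ← laurentCoeff_const_mul]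
        refine laurentCoeff_congr hr _ fun z hz => ?_
        have hz0 := ne_zero_of_norm_eq hr hz
        have e1 : a * q * (s * z) ^ 2 = a * q * z ^ 2 * q := by rw [mul_pow, hs]; ring
        have e2 : 1 / (a * (s * z) ^ 2) * q = 1 / (a * z ^ 2) := by
          rw [mul_pow, hs]
          field_simp
        have e3 : qPoch (a * q * z ^ 2) q (m + 1) =
            (1 - a * q * z ^ 2) * qPoch (a * q * z ^ 2 * q) q m := by
          rw [qPoch, Finset.prod_range_succ', mul_comm, pow_zero, mul_one, qPoch]
          congr 1
          refine Finset.prod_congr rfl fun i _ => ?_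
          ring
        simp only [hg]
        rw [e1, e3, qPochInf_eq_one_sub_mul hq (1 / (a * (s * z) ^ 2)), e2, zpow_ofNat, mul_pow, hs]
        field_simp
        ring
      rw [laurentCoeff_const_mul, laurentCoeff_zpow_mul hr, zero_sub, h2] at h3
      have h4 : q * s ^ (-2 : ℤ) = 1 := by
        rw [zpow_neg, zpow_ofNat, hs, mul_inv_cancel₀ hq0]
      have h5 : a * laurentCoeff r (-2) (g m) = -laurentCoeff r 0 (g (m + 1)) := by
        rw [← h3]
        linear_combination -(a * laurentCoeff r (-2) (g m)) * h4
      rw [pow_succ] at h1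
      linear_combination h1 - q ^ m * q * h5
  induction m with
  | zero => simpa [qPoch, hg] using base
  | succ m ih => rw [qPoch_succ, ← mul_assoc, mul_right_comm, step m, ih]

/-- The constant term of `(aqz², 1/(az²);q)_∞`, a case of the Jacobi triple product. -/
theorem laurentCoeff_theta (hq : ‖q‖ < 1) (ha : a ≠ 0) (hr : 0 < r) :
    laurentCoeff r 0 (thetaQuot a 0 0 0 0 q) * qPochInf q q = 1 := by
  have hcont : ContinuousOn (fun z : ℂ => qPochInf (1 / (a * z ^ 2)) q) (Metric.sphere 0 r) := by
    refine (continuous_qPochInf hq).comp_continuousOn (f := fun z : ℂ => 1 / (a * z ^ 2)) ?_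
    exact continuousOn_const.div (by fun_prop) fun z hz =>
      mul_ne_zero ha (pow_ne_zero 2 (ne_zero_of_norm_eq hr (by simpa using hz)))
  obtain ⟨C, hC⟩ := (isCompact_sphere (0 : ℂ) r).exists_bound_of_continuousOn hcont
  have ht : Tendsto (fun m => laurentCoeff r 0
      (fun z => qPoch (a * q * z ^ 2) q m * qPochInf (1 / (a * z ^ 2)) q)) atTop
      (𝓝 (laurentCoeff r 0 (thetaQuot a 0 0 0 0 q))) := by
    refine tendsto_laurentCoeff hr 0 (C := Real.exp (‖a * q‖ * r ^ 2 / (1 - ‖q‖)) * C)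
      (fun m => ?_) (fun m z hz => ?_) (fun z hz => ?_)
    · exact (((differentiable_qPoch q m).continuous.comp (by fun_prop :
        Continuous fun z : ℂ => a * q * z ^ 2)).continuousOn).mul hcont
    · rw [norm_mul]
      gcongr
      · have := norm_qPoch_le hq (a * q * z ^ 2) m
        rwa [norm_mul (a * q), norm_pow, hz] at this
      · exact hC z (by simpa using hz)
    · have := (tendsto_qPoch hq (a * q * z ^ 2)).mul_const (qPochInf (1 / (a * z ^ 2)) q)
      simpa [thetaQuot, qPochInf_zero_left] using this
  refine tendsto_nhds_unique (ht.mul (tendsto_qPoch hq q)) ?_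
  simp only [laurentCoeff_qPoch_mul_qPochInf hq ha hr]
  exact tendsto_const_nhds

/-- Antisymmetry of the coefficients in the symmetric case: the two circles interchanged by the
reflection lie in the same annulus. -/
theorem laurentCoeff_thetaQuot_symm (hq : ‖q‖ < 1) (h : InAnnulus a c d c d r) (j : ℤ) :
    a ^ j * laurentCoeff r (-j) (thetaQuot a c d c d q) =
      -a * laurentCoeff r (j - 2) (thetaQuot a c d c d q) := by
  rw [← laurentCoeff_thetaQuot_reflect hq h, h.laurentCoeff_eq hq h.reflect]

theorem laurentCoeff_thetaQuot_neg_one (hq : ‖q‖ < 1) (h : InAnnulus a c d c d r) :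
    laurentCoeff r (-1) (thetaQuot a c d c d q) = 0 := by
  have h1 := laurentCoeff_thetaQuot_symm hq h 1
  rw [zpow_one, show (1 : ℤ) - 2 = -1 by norm_num] at h1
  have h2 : a * laurentCoeff r (-1) (thetaQuot a c d c d q) = 0 := by linear_combination h1 / 2
  exact (mul_eq_zero.1 h2).resolve_left h.a_ne_zero

theorem laurentCoeff_thetaQuot_neg_two (hq : ‖q‖ < 1) (h : InAnnulus a c d c d r) :
    a * laurentCoeff r (-2) (thetaQuot a c d c d q) =
      -laurentCoeff r 0 (thetaQuot a c d c d q) := by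
  have h1 := laurentCoeff_thetaQuot_symm hq h 2
  rw [zpow_ofNat, show (2 : ℤ) - 2 = 0 by norm_num] at h1
  exact mul_left_cancel₀ h.a_ne_zero (by linear_combination h1)

theorem laurentCoeff_thetaQuot_neg_three (hq : ‖q‖ < 1) (h : InAnnulus a c d c d r) :
    a ^ 2 * laurentCoeff r (-3) (thetaQuot a c d c d q) =
      -laurentCoeff r 1 (thetaQuot a c d c d q) := by
  have h1 := laurentCoeff_thetaQuot_symm hq h 3
  rw [zpow_ofNat, show (3 : ℤ) - 2 = 1 by norm_num] at h1
  exact mul_left_cancel₀ h.a_ne_zero (by linear_combination h1)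

theorem laurentCoeff_thetaQuot_one (hq : ‖q‖ < 1) (h : InAnnulus a c d c d r) :
    laurentCoeff r 1 (thetaQuot a c d c d q) =
      (c + d) * laurentCoeff r 0 (thetaQuot a c d c d q) := by
  have h1 := laurentCoeff_thetaQuot_recurrence hq h 0
  norm_num at h1
  rw [laurentCoeff_thetaQuot_neg_three hq h] at h1
  have h2 := laurentCoeff_thetaQuot_neg_two hq h
  linear_combination (h1 - (c + d) * h2) / 2

/-- Replacing `d` by `dq` multiplies the constant term by `1 - cd/a`. -/
theorem laurentCoeff_thetaQuot_zero_mul_q (hq : ‖q‖ < 1) (h : InAnnulus a c d c d r) :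
    laurentCoeff r 0 (thetaQuot a c (d * q) c (d * q) q) =
      (1 - c * d / a) * laurentCoeff r 0 (thetaQuot a c d c d q) := by
  have h' : InAnnulus a d c (d * q) c r := (h.mono le_rfl le_rfl le_rfl (norm_mul_q_le hq d)).swap
  have ha := h.a_ne_zero
  rw [thetaQuot_swap, laurentCoeff_thetaQuot_mul_q_left hq h',
    laurentCoeff_thetaQuot_mul_q_right hq h.swap, laurentCoeff_thetaQuot_mul_q_right hq h.swap,
    thetaQuot_swap]
  norm_num
  rw [laurentCoeff_thetaQuot_one hq h, laurentCoeff_thetaQuot_neg_one hq h]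
  field_simp
  ring

/-- Iterating `d ↦ dq` and passing to the limit eliminates the parameter `d`. -/
theorem laurentCoeff_thetaQuot_zero_eq_limit (hq : ‖q‖ < 1) (h : InAnnulus a c d c d r) :
    laurentCoeff r 0 (thetaQuot a c 0 c 0 q) =
      qPochInf (c * d / a) q * laurentCoeff r 0 (thetaQuot a c d c d q) := by
  have hN : ∀ N : ℕ, InAnnulus a c (d * q ^ N) c (d * q ^ N) r := fun N => by
    have : ‖d * q ^ N‖ ≤ ‖d‖ := by
      rw [norm_mul, norm_pow]
      exact mul_le_of_le_one_right (norm_nonneg _) (pow_le_one₀ (norm_nonneg _) hq.le)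
    exact h.mono le_rfl this le_rfl this
  have hval : ∀ N : ℕ, laurentCoeff r 0 (thetaQuot a c (d * q ^ N) c (d * q ^ N) q) =
      qPoch (c * d / a) q N * laurentCoeff r 0 (thetaQuot a c d c d q) := by
    intro N
    induction N with
    | zero => simp [qPoch]
    | succ N ih =>
      rw [pow_succ, ← mul_assoc, laurentCoeff_thetaQuot_zero_mul_q hq (hN N), ih, qPoch_succ]
      ring
  have hfac : ∀ (N : ℕ) (z : ℂ), ‖z‖ = r → thetaQuot a c (d * q ^ N) c (d * q ^ N) q z =
      qPoch (d * z) q N * qPoch (d / (a * z)) q N * thetaQuot a c d c d q z := by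
    intro N z hz
    induction N with
    | zero => simp [qPoch]
    | succ N ih =>
      rw [pow_succ, ← mul_assoc, thetaQuot_swap,
        thetaQuot_mul_q_left hq ((hN N).mono le_rfl le_rfl le_rfl (norm_mul_q_le hq _)).swap hz,
        thetaQuot_mul_q_right hq (hN N).swap hz, thetaQuot_swap, ih, qPoch_succ, qPoch_succ]
      ring
  obtain ⟨C, hC⟩ := (isCompact_sphere (0 : ℂ) r).exists_bound_of_continuousOn (h.continuousOn hq)
  refine tendsto_nhds_unique (tendsto_laurentCoeff h.pos 0
    (F := fun N => thetaQuot a c (d * q ^ N) c (d * q ^ N) q)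
    (C := Real.exp (‖d‖ * r / (1 - ‖q‖)) * Real.exp (1 / (1 - ‖q‖)) * C)
    (fun N => (hN N).continuousOn hq) (fun N z hz => ?_) (fun z hz => ?_)) ?_
  · rw [hfac N z hz, norm_mul, norm_mul]
    have h1 : 0 < 1 - ‖q‖ := by linarith
    gcongr
    · have := norm_qPoch_le hq (d * z) N
      rwa [norm_mul, hz] at this
    · refine (norm_qPoch_le hq _ N).trans ?_
      gcongr
      exact (h.swap.norm_div_lt hz).le
    · exact hC z (by simpa using hz)
  · have hlim : thetaQuot a c 0 c 0 q z =
        qPochInf (d * z) q * qPochInf (d / (a * z)) q * thetaQuot a c d c d q z := by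
      have h1 := qPochInf_ne_zero hq (h.swap.norm_mul_lt hz)
      have h2 := qPochInf_ne_zero hq (h.swap.norm_div_lt hz)
      have h3 := qPochInf_ne_zero hq (h.norm_mul_lt hz)
      have h4 := qPochInf_ne_zero hq (h.norm_div_lt hz)
      simp only [thetaQuot, zero_mul, zero_div, qPochInf_zero_left]
      generalize qPochInf (c * z) q = C₁ at *
      generalize qPochInf (d * z) q = D₁ at *
      generalize qPochInf (c / (a * z)) q = C₂ at *
      generalize qPochInf (d / (a * z)) q = D₂ at *
      field_simp
    rw [hlim]
    simp only [hfac _ z hz]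
    exact ((tendsto_qPoch hq _).mul (tendsto_qPoch hq _)).mul_const _
  · simp only [hval]
    exact (tendsto_qPoch hq _).mul_const _

/-- The Al-Salam–Chihara constant term: that of
`(aqz², 1/(az²);q)_∞ / (cz, dz, c/(az), d/(az);q)_∞` is `1/(q, cd/a;q)_∞`. -/
theorem laurentCoeff_thetaQuot_zero (hq : ‖q‖ < 1) (h : InAnnulus a c d c d r) :
    qPochInf q q * qPochInf (c * d / a) q * laurentCoeff r 0 (thetaQuot a c d c d q) = 1 := by
  have h0 : InAnnulus a 0 c 0 c r := (h.mono le_rfl (by simp) le_rfl (by simp)).swap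
  have h1 := laurentCoeff_thetaQuot_zero_eq_limit hq h
  have h2 := laurentCoeff_thetaQuot_zero_eq_limit hq h0
  rw [zero_mul, zero_div, qPochInf_zero_left, one_mul, thetaQuot_swap a 0 c] at h2
  have h3 := laurentCoeff_theta hq h.a_ne_zero h.pos
  rw [h2, h1] at h3
  linear_combination h3

end

section

open PowerSeries

/-! ### The base series as formal power series -/

theorem constantCoeff_qPochSeries (c q : ℂ) (k : ℕ) : constantCoeff (qPochSeries c q k) = 1 := by
  simp [qPochSeries, map_prod]

theorem qPochSeries_ne_zero (c q : ℂ) (k : ℕ) : qPochSeries c q k ≠ 0 := fun h => by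
  have := constantCoeff_qPochSeries c q k
  rw [h] at this
  simp at this

theorem baseSeries_mul_qPochSeries (A B q : ℂ) (k : ℕ) :
    baseSeries A B q k * qPochSeries B q k = X ^ k * qPochSeries A q k := by
  rw [baseSeries, mul_assoc, PowerSeries.inv_mul_cancel _ (by simp [constantCoeff_qPochSeries]),
    mul_one]

theorem qPochSeries_succ (c q : ℂ) (k : ℕ) :
    qPochSeries c q (k + 1) = qPochSeries c q k * (1 - C (c * q ^ k) * X) :=
  Finset.prod_range_succ _ _

theorem rescale_C (s c : ℂ) : rescale s (C c) = C c := by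
  ext n
  rcases n with _ | n <;> simp [coeff_rescale, coeff_C]

theorem baseSeries_zero (A B q : ℂ) : baseSeries A B q 0 = 1 := by
  simpa [qPochSeries] using baseSeries_mul_qPochSeries A B q 0

theorem X_pow_dvd_baseSeries (A B q : ℂ) (k : ℕ) : X ^ k ∣ baseSeries A B q k := by
  rw [baseSeries, mul_assoc]
  exact dvd_mul_right _ _

theorem baseSeries_succ_mul (A B q : ℂ) (k : ℕ) :
    baseSeries A B q (k + 1) * (1 - C (B * q ^ k) * X) =
      baseSeries A B q k * (X * (1 - C (A * q ^ k) * X)) := by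
  have h1 := baseSeries_mul_qPochSeries A B q (k + 1)
  have h0 := baseSeries_mul_qPochSeries A B q k
  refine mul_right_cancel₀ (qPochSeries_ne_zero B q k) ?_
  rw [qPochSeries_succ, qPochSeries_succ] at h1
  linear_combination h1 - (X * (1 - C (A * q ^ k) * X)) * h0

theorem qPochSeries_add (c q : ℂ) (j m : ℕ) :
    qPochSeries c q (j + m) = qPochSeries c q j * rescale (q ^ j) (qPochSeries c q m) := by
  simp only [qPochSeries, Finset.prod_range_add, map_prod]
  congr 1
  refine Finset.prod_congr rfl fun i _ => ?_
  rw [map_sub, map_one, map_mul (rescale _), rescale_X, rescale_C, pow_add]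
  simp only [map_mul]
  ring

/-- Splitting off the first `j` factors rescales the remaining base series by `q ^ j`. -/
theorem baseSeries_mul_rescale (A B q : ℂ) (j m : ℕ) :
    baseSeries A B q j * rescale (q ^ j) (baseSeries A B q m) =
      C (q ^ (m * j)) * baseSeries A B q (j + m) := by
  have h1 := baseSeries_mul_qPochSeries A B q j
  have h2 := congrArg (rescale (q ^ j)) (baseSeries_mul_qPochSeries A B q m)
  have h3 := baseSeries_mul_qPochSeries A B q (j + m)
  rw [map_mul, map_mul, map_pow, rescale_X] at h2
  refine mul_right_cancel₀ (qPochSeries_ne_zero B q (j + m)) ?_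
  rw [mul_assoc _ (baseSeries A B q (j + m)), h3, qPochSeries_add, qPochSeries_add]
  have h4 : (C (q ^ (m * j)) : PowerSeries ℂ) = C (q ^ j) ^ m := by
    rw [← map_pow]
    ring_nf
  rw [h4]
  calc _ = (baseSeries A B q j * qPochSeries B q j) *
        (rescale (q ^ j) (baseSeries A B q m) * rescale (q ^ j) (qPochSeries B q m)) := by ring
    _ = _ := by
      rw [h1, h2]
      ring

theorem X_pow_dvd_rescale {m : ℕ} {f : PowerSeries ℂ} (h : X ^ m ∣ f) (s : ℂ) :
    X ^ m ∣ rescale s f := by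
  have := map_dvd (rescale s) h
  rw [map_pow, rescale_X, mul_pow] at this
  exact (dvd_mul_left _ _).trans this

/-! ### The generating function of the moments -/

/-- The partial sums of `∑ₖ zᵏ (aqz;q)ₖ/(bqz;q)ₖ` satisfy the functional equation obtained from
one step of the Rogers–Fine iteration, up to a remainder of order at least `N`. -/
theorem sum_baseSeries_functional (a b q : ℂ) (N : ℕ) :
    (1 - X) * (1 - C (b * q) * X) * ∑ k ∈ Finset.range N, baseSeries (a * q) (b * q) q k =
      (1 - C (b * q) * X) * (1 - C (a * q) * X ^ 2) +
        C q * X ^ 2 * (C b - C (a * q) * X) * (1 - C (a * q) * X) *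
          rescale q (∑ k ∈ Finset.range N, baseSeries (a * q) (b * q) q k) -
        (1 - C (b * q) * X) * (1 - C (a * q * q ^ N) * X ^ 2) * baseSeries (a * q) (b * q) q N := by
  induction N with
  | zero =>
    simp only [Finset.range_zero, Finset.sum_empty, map_zero, baseSeries_zero, pow_zero, mul_one]
    ring
  | succ N ih =>
    rw [Finset.sum_range_succ, map_add]
    have h1 := baseSeries_succ_mul (a * q) (b * q) q N
    have h2 := baseSeries_mul_rescale (a * q) (b * q) q 1 N
    have h3 := baseSeries_succ_mul (a * q) (b * q) q 0
    rw [baseSeries_zero, zero_add, pow_zero, mul_one, mul_one, one_mul] at h3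
    rw [mul_one, pow_one, add_comm 1 N] at h2
    have h4 : X * (1 - C (a * q) * X) * rescale q (baseSeries (a * q) (b * q) q N) =
        (1 - C (b * q) * X) * (C (q ^ N) * baseSeries (a * q) (b * q) q (N + 1)) := by
      rw [← h2, ← h3]
      ring
    simp only [map_mul, map_pow, pow_succ] at *
    linear_combination ih + (1 - C b * C q * X) * h1 - C q * X * (C b - C a * C q * X) * h4

/-- The functional equation determines its solution from `κ`: in the homogeneous equation the factor
`X ^ 2` raises the order of a solution indefinitely. -/
theorem coeff_eq_of_functional (a b q κ : ℂ) (K : PowerSeries ℂ)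
    (hK : (1 - X) * (1 - C (b * q) * X) * K =
      C κ * ((1 - C (b * q) * X) * (1 - C (a * q) * X ^ 2)) +
        C q * X ^ 2 * (C b - C (a * q) * X) * (1 - C (a * q) * X) * rescale q K) (n : ℕ) :
    coeff n K = κ * ∑ k ∈ Finset.range (n + 1), coeff n (baseSeries (a * q) (b * q) q k) := by
  -- Only the base series of index at most `n` reach the coefficient of `Xⁿ`.
  set S := ∑ k ∈ Finset.range (n + 1), baseSeries (a * q) (b * q) q k
  have hS := sum_baseSeries_functional a b q (n + 1)
  have hΔ : (1 - X) * (1 - C (b * q) * X) * (K - C κ * S) =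
      C q * X ^ 2 * (C b - C (a * q) * X) * (1 - C (a * q) * X) * rescale q (K - C κ * S) +
        C κ * (1 - C (b * q) * X) * (1 - C (a * q * q ^ (n + 1)) * X ^ 2) *
          baseSeries (a * q) (b * q) q (n + 1) := by
    rw [map_sub, map_mul (rescale q), rescale_C]
    linear_combination hK - C κ * hS
  have hdvd : ∀ m ≤ n + 1, X ^ m ∣ K - C κ * S := by
    intro m
    induction m with
    | zero => simp
    | succ m ih =>
      intro hm
      have hu : IsUnit ((1 - X) * (1 - C (b * q) * X) : PowerSeries ℂ) := by
        rw [isUnit_iff_constantCoeff]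
        simp
      rw [← hu.dvd_mul_left, hΔ]
      refine dvd_add ?_ ?_
      · have h1 : X ^ (m + 1) ∣ X ^ 2 * rescale q (K - C κ * S) := by
          refine (pow_dvd_pow X (by omega : m + 1 ≤ 2 + m)).trans ?_
          rw [pow_add]
          exact mul_dvd_mul_left _ (X_pow_dvd_rescale (ih (by omega)) q)
        refine h1.trans ⟨C q * (C b - C (a * q) * X) * (1 - C (a * q) * X), ?_⟩
        ring
      · exact ((pow_dvd_pow X hm).trans (X_pow_dvd_baseSeries _ _ _ _)).mul_left _
  have h := X_pow_dvd_iff.1 (hdvd (n + 1) le_rfl) n (Nat.lt_succ_self n)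
  rw [map_sub, coeff_C_mul, sub_eq_zero] at h
  rw [h, map_sum]

/-! ### The inverse relation -/

/-- The coefficient of `Xᴺ` in the expansion of `X/(z - X)` in terms of base series. The sum
telescopes after multiplication by `X - z`. -/
theorem coeff_sum_baseSeries_telescope (a b q z : ℂ) (hz : z ≠ 0) (N : ℕ)
    (hne : ∀ k < N, 1 - a * q * z * q ^ k ≠ 0) (hN : N ≠ 0) :
    ∑ k ∈ Finset.range N, z⁻¹ ^ (k + 1) * (qPoch (b * q * z) q k / qPoch (a * q * z) q (k + 1)) *
      (coeff N (baseSeries (a * q) (b * q) q (k + 1)) -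
        a * q ^ (k + 1) * z * coeff N (X * baseSeries (a * q) (b * q) q k)) = z⁻¹ ^ N := by
  set φ := baseSeries (a * q) (b * q) q with hφ
  set α : ℕ → ℂ := fun k =>
    z⁻¹ ^ (k + 1) * (qPoch (b * q * z) q k / qPoch (a * q * z) q (k + 1)) with hα
  set γ : ℕ → ℂ := fun k => z⁻¹ ^ k * (qPoch (b * q * z) q k / qPoch (a * q * z) q k) with hγ
  set P : ℕ → PowerSeries ℂ := fun M => ∑ k ∈ Finset.range M,
    C (α k) * (φ (k + 1) - C (a * q ^ (k + 1) * z) * (X * φ k)) with hP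
  have key : ∀ M ≤ N, (X - C z) * P M = X * (C (γ M) * φ M - 1) := by
    intro M
    induction M with
    | zero =>
      intro _
      simp [hP, hγ, hφ, qPoch, baseSeries_zero]
    | succ M ih =>
      intro hM
      have h1 := baseSeries_succ_mul (a * q) (b * q) q M
      have hM' := hne M (by omega)
      have e1 : γ M = α M * (z * (1 - a * q ^ (M + 1) * z)) := by
        simp only [hγ, hα, qPoch_succ]
        rw [show a * q ^ (M + 1) * z = a * q * z * q ^ M by ring,
          pow_succ z⁻¹]
        generalize qPoch (b * q * z) q M = x
        generalize qPoch (a * q * z) q M = y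
        generalize 1 - a * q * z * q ^ M = t at hM'
        field_simp
      have e2 : γ (M + 1) = α M * (1 - b * q ^ (M + 1) * z) := by
        simp only [hγ, hα, qPoch_succ]
        rw [show b * q ^ (M + 1) * z = b * q * z * q ^ M by ring]
        ring
      have h2 := ih (by omega)
      simp only [hP] at h2 ⊢
      rw [Finset.sum_range_succ, mul_add, h2, e1, e2]
      simp only [← hφ, map_mul, map_sub, map_one, map_pow, pow_succ] at h1 ⊢
      linear_combination (-(C (α M) * C z)) * h1
  have hgeom : (X - C z) * (mk fun n => z⁻¹ ^ n) = -C z := by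
    ext n
    rw [sub_mul, map_sub, coeff_C_mul]
    rcases n with _ | n
    · simp
    · rw [coeff_succ_X_mul, coeff_mk, coeff_mk, map_neg, coeff_C, if_neg n.succ_ne_zero, pow_succ]
      field_simp
      simp
  have hu : IsUnit (X - C z : PowerSeries ℂ) := by
    rw [isUnit_iff_constantCoeff]
    simpa using hz
  have hdvd : X ^ (N + 1) ∣ P N - ((mk fun n => z⁻¹ ^ n) - 1) := by
    rw [← hu.dvd_mul_left]
    have h2 : (X - C z) * (P N - ((mk fun n => z⁻¹ ^ n) - 1)) = C (γ N) * (X * φ N) := by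
      linear_combination key N le_rfl - hgeom
    rw [h2, pow_succ']
    exact (mul_dvd_mul_left X (X_pow_dvd_baseSeries _ _ _ _)).mul_left _
  have h := X_pow_dvd_iff.1 hdvd N (Nat.lt_succ_self N)
  rw [map_sub, map_sub, coeff_mk, coeff_one, if_neg hN, sub_zero, sub_eq_zero] at h
  rw [← h]
  simp only [hP, hα, map_sum, coeff_C_mul, map_sub]

/-- The expansion of `X` in base series, rescaled by `q ^ j` and multiplied by the `j`-th one. -/
theorem sum_invCoeff_mul_coeff_baseSeries (A B q : ℂ) {j N : ℕ} (hj : j ≤ N) :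
    ∑ m ∈ Finset.range (N + 1 - j), invCoeff A B q m 1 * q ^ (m * j) *
      coeff N (baseSeries A B q (j + m)) = q ^ j * coeff N (X * baseSeries A B q j) := by
  set M := N + 1 - j with hM
  have h0 : X ^ M ∣ (∑ m ∈ Finset.range M, C (invCoeff A B q m 1) * baseSeries A B q m) - X := by
    rw [X_pow_dvd_iff]
    intro i hi
    have h1 := (expansion_iff_eq_invCoeff A B q 1 fun m => invCoeff A B q m 1).2 (fun _ => rfl) i
    rw [map_sub, sub_eq_zero, map_sum, ← pow_one X, h1]
    simp only [coeff_C_mul]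
    refine (Finset.sum_subset (Finset.range_subset_range.2 (by omega)) fun m _ hm => ?_).symm
    rw [coeff_baseSeries_of_lt _ _ _ (by simpa using hm), mul_zero]
  have h2 := mul_dvd_mul (X_pow_dvd_baseSeries A B q j) (X_pow_dvd_rescale h0 (q ^ j))
  rw [← pow_add, show j + M = N + 1 by omega, map_sub, map_sum, mul_sub, Finset.mul_sum,
    rescale_X] at h2
  have h3 := X_pow_dvd_iff.1 h2 N (Nat.lt_succ_self N)
  rw [map_sub, sub_eq_zero, map_sum] at h3
  rw [mul_left_comm, coeff_C_mul, mul_comm (baseSeries A B q j) X] at h3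
  rw [← h3]
  refine Finset.sum_congr rfl fun m _ => ?_
  rw [map_mul (rescale _), rescale_C, mul_left_comm, baseSeries_mul_rescale, coeff_C_mul,
    coeff_C_mul, mul_assoc]

/-- Inversion of the triangular system satisfied by two sequences `D` and `E`. -/
theorem eq_add_sum_invCoeff (a b q κ : ℂ) (D E : ℕ → ℂ) (n : ℕ)
    (h : ∀ N, N ≠ 0 → N ≤ n → ∑ k ∈ Finset.range N,
      (D (k + 1) * coeff N (baseSeries (a * q) (b * q) q (k + 1)) -
        a * q ^ (k + 1) * E k * coeff N (X * baseSeries (a * q) (b * q) q k)) =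
      κ * ∑ k ∈ Finset.range (N + 1), coeff N (baseSeries (a * q) (b * q) q k)) :
    ∀ N, N ≠ 0 → N ≤ n → D N = κ + a * q * ∑ k ∈ Finset.range N,
      invCoeff (a * q) (b * q) q (N - k) 1 * q ^ ((N - k) * k) * E k := by
  set φ := baseSeries (a * q) (b * q) q with hφ
  set β : ℕ → ℂ := fun m => invCoeff (a * q) (b * q) q m 1 with hβ
  -- The right-hand side `D'` of the claim solves the same triangular system as `D`, whose diagonal
  -- coefficients are `1`.
  set D' : ℕ → ℂ := fun N => κ + a * q * ∑ k ∈ Finset.range N, β (N - k) * q ^ ((N - k) * k) * E k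
    with hD'
  have hβ0 : β 0 = 0 := by
    simp only [hβ]
    rw [invCoeff]
    simp
  have hD : ∀ N, N ≠ 0 → ∑ k ∈ Finset.range N, (D' (k + 1) * coeff N (φ (k + 1)) -
      a * q ^ (k + 1) * E k * coeff N (X * φ k)) =
      κ * ∑ k ∈ Finset.range (N + 1), coeff N (φ k) := by
    intro N hN
    have h1 : ∑ k ∈ Finset.range N, D' (k + 1) * coeff N (φ (k + 1)) =
        ∑ k ∈ Finset.range (N + 1), D' k * coeff N (φ k) := by
      rw [Finset.sum_range_succ']
      simp [hφ, baseSeries_zero, coeff_one, hN]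
    have h2 : ∀ k, D' k = κ + a * q *
        ∑ j ∈ Finset.range (k + 1), β (k - j) * q ^ ((k - j) * j) * E j := fun k => by
      rw [Finset.sum_range_succ]
      simp [hD', hβ0]
    have h3 : ∑ k ∈ Finset.range (N + 1), ∑ j ∈ Finset.range (k + 1),
        β (k - j) * q ^ ((k - j) * j) * E j * coeff N (φ k) =
        ∑ j ∈ Finset.range (N + 1), E j * (q ^ j * coeff N (X * φ j)) := by
      rw [Finset.sum_comm' (s' := fun j => Finset.Ico j (N + 1)) (t' := Finset.range (N + 1))
        (by intro x y; simp only [Finset.mem_range, Finset.mem_Ico]; omega)]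
      refine Finset.sum_congr rfl fun j hj => ?_
      rw [← sum_invCoeff_mul_coeff_baseSeries _ _ _ (Nat.lt_succ_iff.1 (Finset.mem_range.1 hj)),
        Finset.sum_Ico_eq_sum_range, Finset.mul_sum]
      refine Finset.sum_congr rfl fun m _ => ?_
      rw [Nat.add_sub_cancel_left]
      ring
    have h4 : coeff N (X * φ N) = 0 := by
      obtain ⟨m, rfl⟩ := Nat.exists_eq_succ_of_ne_zero hN
      rw [Nat.succ_eq_add_one, coeff_succ_X_mul, hφ]
      exact coeff_baseSeries_of_lt _ _ _ (Nat.lt_succ_self m)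
    rw [Finset.sum_range_succ (fun j => E j * (q ^ j * coeff N (X * φ j))) N, h4, mul_zero,
      mul_zero, add_zero] at h3
    rw [Finset.sum_sub_distrib, h1]
    simp only [h2, add_mul]
    rw [Finset.sum_add_distrib, ← Finset.mul_sum]
    have h5 : ∑ k ∈ Finset.range (N + 1), a * q *
        (∑ j ∈ Finset.range (k + 1), β (k - j) * q ^ ((k - j) * j) * E j) * coeff N (φ k) =
        ∑ k ∈ Finset.range N, a * q ^ (k + 1) * E k * coeff N (X * φ k) := by
      simp only [mul_assoc (a * q), Finset.sum_mul]
      rw [← Finset.mul_sum, h3, Finset.mul_sum]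
      refine Finset.sum_congr rfl fun k _ => ?_
      ring
    rw [h5]
    ring
  intro N
  induction N using Nat.strong_induction_on with
  | _ N ih =>
    intro hN hNn
    have h1 := (h N hN hNn).trans (hD N hN).symm
    obtain ⟨m, rfl⟩ := Nat.exists_eq_succ_of_ne_zero hN
    rw [Nat.succ_eq_add_one, Finset.sum_range_succ, Finset.sum_range_succ _ m,
      Finset.sum_congr rfl fun k hk => by
        rw [ih (k + 1) (by simp at hk; omega) k.succ_ne_zero (by simp at hk; omega)]] at h1
    have h2 : coeff (m + 1) (φ (m + 1)) = 1 := coeff_baseSeries_self _ _ _ _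
    rw [h2] at h1
    have h3 := add_left_cancel h1
    change D (m + 1) = D' (m + 1)
    linear_combination h3

end

section

open Filter Topology Complex

variable {a b q : ℂ} {r : ℝ}

/-! ### The moments of the kernel -/

/-- The constant term of the kernel `thetaQuot a 1 (b * q) 1 b q` and its first neighbours, obtained
by comparison with the symmetric quotient `thetaQuot a 1 (b * q) 1 (b * q) q`. -/
theorem kernel_initial (hq : ‖q‖ < 1) (h : InAnnulus a 1 (b * q) 1 b r) :
    qPochInf q q * qPochInf (b / a) q * laurentCoeff r 0 (thetaQuot a 1 (b * q) 1 b q) = 1 ∧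
    laurentCoeff r 1 (thetaQuot a 1 (b * q) 1 b q) =
      laurentCoeff r 0 (thetaQuot a 1 (b * q) 1 b q) ∧
    a * laurentCoeff r (-1) (thetaQuot a 1 (b * q) 1 b q) =
      b * laurentCoeff r 0 (thetaQuot a 1 (b * q) 1 b q) ∧
    a ^ 2 * laurentCoeff r (-2) (thetaQuot a 1 (b * q) 1 b q) =
      (b ^ 2 + b - a) * laurentCoeff r 0 (thetaQuot a 1 (b * q) 1 b q) := by
  have ha := h.a_ne_zero
  have hs : InAnnulus a 1 (b * q) 1 (b * q) r := h.mono le_rfl le_rfl le_rfl (norm_mul_q_le hq b)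
  have hrel : ∀ j, laurentCoeff r j (thetaQuot a 1 (b * q) 1 (b * q) q) =
      laurentCoeff r j (thetaQuot a 1 (b * q) 1 b q) -
        b / a * laurentCoeff r (j + 1) (thetaQuot a 1 (b * q) 1 b q) := fun j => by
    rw [thetaQuot_swap, laurentCoeff_thetaQuot_mul_q_right hq h.swap, thetaQuot_swap]
  have h1 := laurentCoeff_thetaQuot_neg_one hq hs
  have h2 := laurentCoeff_thetaQuot_neg_two hq hs
  have h3 := laurentCoeff_thetaQuot_neg_three hq hs
  have h4 := laurentCoeff_thetaQuot_one hq hs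
  have h0 := laurentCoeff_thetaQuot_zero hq hs
  have hrec := laurentCoeff_thetaQuot_recurrence hq h 0
  rw [hrel 1] at h3 h4
  rw [hrel (-1)] at h1
  rw [hrel (-2)] at h2
  rw [hrel (-3)] at h3
  rw [hrel 0] at h2 h4 h0
  norm_num at h0 h1 h2 h3 h4 hrec
  generalize laurentCoeff r 0 (thetaQuot a 1 (b * q) 1 b q) = x₀ at *
  generalize laurentCoeff r 1 (thetaQuot a 1 (b * q) 1 b q) = x₁ at *
  generalize laurentCoeff r 2 (thetaQuot a 1 (b * q) 1 b q) = x₂ at *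
  generalize laurentCoeff r (-1) (thetaQuot a 1 (b * q) 1 b q) = y₁ at *
  generalize laurentCoeff r (-2) (thetaQuot a 1 (b * q) 1 b q) = y₂ at *
  generalize laurentCoeff r (-3) (thetaQuot a 1 (b * q) 1 b q) = y₃ at *
  have k1 : a * y₁ = b * x₀ := by
    field_simp at h1
    linear_combination h1
  -- Together with `k1` this says that `(a - b²q) (x₁ - x₀) = 0`.
  have k2 : x₁ - (1 + b * q) * x₀ + b * q * y₁ = -(b * q) * (x₀ - b / a * x₁) := by
    have e1 : a ^ 2 * y₃ - a * (1 + b) * y₂ + b * y₁ =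
        a ^ 2 * (y₃ - b / a * y₂) - a * (y₂ - b / a * y₁) := by
      field_simp
      ring
    rw [e1] at hrec
    linear_combination hrec + h3 - h2 - h4
  have hdet : a - b ^ 2 * q ≠ 0 := by
    intro h5
    have h6 : ‖a‖ = ‖b‖ * ‖b * q‖ := by
      rw [← norm_mul]
      congr 1
      linear_combination h5
    have h7 := h.f_lt
    have h8 := h.d_lt
    rw [h6, mul_assoc] at h7
    have := mul_le_of_le_one_right (norm_nonneg b) h8.le
    linarith
  have k3 : x₁ = x₀ := by
    have h5 : (a - b ^ 2 * q) * (x₁ - x₀) = 0 := by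
      have e2 : a * (x₁ - (1 + b * q) * x₀ + b * q * y₁) =
          -(b * q) * (a * x₀ - b * x₁) := by
        rw [k2]
        field_simp
      linear_combination e2 - b * q * k1
    exact sub_eq_zero.1 ((mul_eq_zero.1 h5).resolve_left hdet)
  refine ⟨?_, k3, k1, ?_⟩
  · rw [qPochInf_eq_one_sub_mul hq (b / a), div_mul_eq_mul_div]
    rw [k3] at h0
    linear_combination h0
  · rw [k3] at h2
    field_simp at h2
    linear_combination h2 + b * k1

open PowerSeries in
/-- The nonnegative moments of the kernel are proportional to the coefficients of
`∑ₖ zᵏ (aqz;q)ₖ/(bqz;q)ₖ`. -/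
theorem laurentCoeff_kernel (hq : ‖q‖ < 1) (h : InAnnulus a 1 (b * q) 1 b r) (n : ℕ) :
    laurentCoeff r n (thetaQuot a 1 (b * q) 1 b q) =
      1 / (qPochInf q q * qPochInf (b / a) q) *
        ∑ k ∈ Finset.range (n + 1), coeff n (baseSeries (a * q) (b * q) q k) := by
  obtain ⟨h0, h1, h2, h3⟩ := kernel_initial hq h
  have hrec := laurentCoeff_thetaQuot_recurrence hq h
  set x : ℤ → ℂ := fun j => laurentCoeff r j (thetaQuot a 1 (b * q) 1 b q) with hx
  change qPochInf q q * qPochInf (b / a) q * x 0 = 1 at h0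
  change x 1 = x 0 at h1
  change a * x (-1) = b * x 0 at h2
  change a ^ 2 * x (-2) = (b ^ 2 + b - a) * x 0 at h3
  change ∀ m : ℕ, x (m + 1) - (1 + b * q) * x m + 1 * (b * q) * x (m - 1) =
    q ^ m * (a ^ 2 * x (m - 3) - a * (1 + b) * x (m - 2) + 1 * b * x (m - 1)) at hrec
  set K : PowerSeries ℂ := mk fun n => x n with hK
  have hfun : (1 - X) * (1 - C (b * q) * X) * K =
      C (x 0) * ((1 - C (b * q) * X) * (1 - C (a * q) * X ^ 2)) +
        C q * X ^ 2 * (C b - C (a * q) * X) * (1 - C (a * q) * X) * rescale q K := by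
    have e1 : (1 - X) * (1 - C (b * q) * X) * K =
        K - X ^ 1 * K - C (b * q) * (X ^ 1 * K) + C (b * q) * (X ^ 2 * K) := by
      ring
    have e2 : C (x 0) * ((1 - C (b * q) * X) * (1 - C (a * q) * X ^ 2)) +
        C q * X ^ 2 * (C b - C (a * q) * X) * (1 - C (a * q) * X) * rescale q K =
        C (x 0) * X ^ 0 - C (x 0 * (b * q)) * X ^ 1 - C (x 0 * (a * q)) * X ^ 2 +
          C (x 0 * (b * q) * (a * q)) * X ^ 3 + C (q * b) * (X ^ 2 * rescale q K) -
          C (q * (a * q) * (1 + b)) * (X ^ 3 * rescale q K) +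
          C (q * (a * q) ^ 2) * (X ^ 4 * rescale q K) := by
      simp only [map_add, map_one, map_mul, map_pow]
      ring
    rw [e1, e2]
    ext n
    simp only [map_add, map_sub, coeff_C_mul, coeff_X_pow_mul', coeff_X_pow, coeff_rescale]
    -- For `n ≤ 3` the recurrence involves coefficients of negative index.
    rcases n with _ | _ | _ | _ | n
    · simp [hK]
    · simp [hK, h1]
      ring
    · have := hrec 1
      norm_num at this
      simp [hK]
      linear_combination this + q * h3 - q * (1 + b) * h2
    · have := hrec 2
      norm_num at this
      simp [hK]
      linear_combination this + q ^ 2 * a * h2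
    · have := hrec (n + 3)
      push_cast at this
      rw [show (n : ℤ) + 3 + 1 = n + 4 by ring, show (n : ℤ) + 3 - 1 = n + 2 by ring,
        show (n : ℤ) + 3 - 3 = n by ring, show (n : ℤ) + 3 - 2 = n + 1 by ring] at this
      simp [hK]
      norm_num [add_assoc]
      linear_combination this
  have h4 := coeff_eq_of_functional a b q (x 0) K hfun n
  rw [hK, coeff_mk] at h4
  have h5 : x 0 = 1 / (qPochInf q q * qPochInf (b / a) q) :=
    eq_one_div_of_mul_eq_one_right h0
  rw [← h5]
  exact h4

/-! ### The functions `H_m` and their coefficients -/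

theorem psiQuot_denom_ne_zero (hq : ‖q‖ < 1) {m : ℕ} (h : InAnnulus a 1 (b * q ^ m) 1 b r)
    (hpole : ∀ i : ℕ, 1 ≤ i → i ≤ m → ‖a * q ^ i‖ * r ≠ 1) {z : ℂ} (hz : ‖z‖ = r) :
    qPochInf z q * qPochInf (b / (a * z)) q * qPochInf (b * q ^ m * z) q *
      qPochInf (1 / (a * z)) q * qPoch (a * q * z) q m ≠ 0 := by
  have h1 := h.norm_mul_lt hz
  rw [one_mul] at h1
  refine mul_ne_zero (mul_ne_zero (mul_ne_zero (mul_ne_zero (qPochInf_ne_zero hq h1)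
    (qPochInf_ne_zero hq (h.swap.norm_div_lt hz))) (qPochInf_ne_zero hq (h.swap.norm_mul_lt hz)))
    (qPochInf_ne_zero hq (h.norm_div_lt hz))) (Finset.prod_ne_zero_iff.2 fun i hi h0 => ?_)
  refine hpole (i + 1) (by omega) (by simpa using hi) ?_
  have h2 : a * q ^ (i + 1) * z = 1 := by
    rw [pow_succ]
    linear_combination -h0
  rw [← hz, ← norm_mul, h2, norm_one]

theorem psiQuot_eventually_differentiableAt (hq : ‖q‖ < 1) {m : ℕ}
    (h : InAnnulus a 1 (b * q ^ m) 1 b r)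
    (hpole : ∀ i : ℕ, 1 ≤ i → i ≤ m → ‖a * q ^ i‖ * r ≠ 1) {z : ℂ} (hz : ‖z‖ = r) :
    ∀ᶠ w in 𝓝 z, DifferentiableAt ℂ (psiQuot a b q m) w := by
  have ha := h.a_ne_zero
  have key : ∀ (g : ℂ → ℂ) (w : ℂ), DifferentiableAt ℂ g w →
      DifferentiableAt ℂ (fun w => qPochInf (g w) q) w :=
    fun g w hg => (differentiable_qPochInf hq (g w)).comp w hg
  have hden : ∀ w : ℂ, w ≠ 0 → DifferentiableAt ℂ (fun z => qPochInf z q *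
      qPochInf (b / (a * z)) q * qPochInf (b * q ^ m * z) q *
      qPochInf (1 / (a * z)) q * qPoch (a * q * z) q m) w := fun w hw => by
    have hne : a * w ≠ 0 := mul_ne_zero ha hw
    refine DifferentiableAt.fun_mul (DifferentiableAt.fun_mul (DifferentiableAt.fun_mul
      (DifferentiableAt.fun_mul (key _ _ (by fun_prop))
        (key _ _ (by fun_prop (disch := assumption)))) (key _ _ (by fun_prop)))
      (key _ _ (by fun_prop (disch := assumption)))) ?_
    exact (differentiable_qPoch q m _).comp w (f := fun z => a * q * z) (by fun_prop)
  have hz0 := ne_zero_of_norm_eq h.pos hz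
  filter_upwards [(hden z hz0).continuousAt.eventually_ne (psiQuot_denom_ne_zero hq h hpole hz),
    isOpen_ne.mem_nhds hz0] with w hw hw0
  have hne2 : a * w ^ 2 ≠ 0 := mul_ne_zero ha (pow_ne_zero 2 hw0)
  unfold psiQuot
  exact DifferentiableAt.fun_div ((key _ _ (by fun_prop)).fun_mul
    (key _ _ (by fun_prop (disch := assumption)))) (hden w hw0) hw

/-- On the circle, every `H_m` with `m ≥ 1` is a rational function times the kernel. -/
theorem psiQuot_succ_eq (hq : ‖q‖ < 1) (h : InAnnulus a 1 (b * q) 1 b r) (k : ℕ) {z : ℂ}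
    (hz : ‖z‖ = r) : psiQuot a b q (k + 1) z =
      qPoch (b * q * z) q k / qPoch (a * q * z) q (k + 1) * thetaQuot a 1 (b * q) 1 b q z := by
  have h1 := qPochInf_eq_qPoch_mul (b * q * z) q hq k
  have h2 : b * q * z * q ^ k = b * q ^ (k + 1) * z := by ring
  have h3 := qPochInf_ne_zero hq (h.swap.norm_mul_lt hz)
  rw [h2] at h1
  rw [h1] at h3
  have h4 := left_ne_zero_of_mul h3
  rw [psiQuot, thetaQuot, h1, one_mul, div_mul_div_comm, ← mul_div_mul_left _ _ h4]
  congr 1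
  ring

end

open Filter Topology in
theorem mainTheorem5 (a b q : ℂ) (hq : ‖q‖ < 1) (n : ℕ) (r : ℝ)
    (hr : ‖b / a‖ < r) (hr1 : r < 1)
    (ha : 1 < ‖a‖ * r)
    (hb : ‖b * q‖ * r < 1) (hb0 : n = 0 → ‖b‖ * r < 1)
    (hpole : ∀ i : ℕ, 1 ≤ i → i ≤ n → ‖a * q ^ i‖ * r ≠ 1) :
    HasLaurentExpansion r (psiQuot a b q n) ∧
    (∀ k : ℕ, k < n → HasLaurentExpansion r (psiQuot a b q (k + 1))) ∧
    laurentCoeff r n (psiQuot a b q n) =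
      1 / (qPochInf q q * qPochInf (b / a) q) +
        a * q * ∑ k ∈ Finset.range n,
          invCoeff (a * q) (b * q) q (n - k) 1 * q ^ ((n - k) * k) *
            laurentCoeff r k (psiQuot a b q (k + 1)) := by
  have hr0 : 0 < r := (norm_nonneg _).trans_lt hr
  have ha0 : 0 < ‖a‖ := pos_of_mul_pos_left (one_pos.trans ha) hr0.le
  have hba : ‖b‖ < ‖a‖ * r := by
    rwa [norm_div, div_lt_iff₀ ha0, mul_comm] at hr
  have hA : ∀ m, (m = 0 → n = 0) → InAnnulus a 1 (b * q ^ m) 1 b r := fun m hm => by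
    refine ⟨hr0, by simpa using hr1, ?_, by simpa using ha, hba⟩
    rcases m with _ | m
    · simpa using hb0 (hm rfl)
    · refine (mul_le_mul_of_nonneg_right ?_ hr0.le).trans_lt hb
      rw [pow_succ', ← mul_assoc, norm_mul, norm_pow]
      exact mul_le_of_le_one_right (norm_nonneg _) (pow_le_one₀ (norm_nonneg _) hq.le)
  have hdiff : ∀ m, (m = 0 → n = 0) → m ≤ n → ∀ z : ℂ, ‖z‖ = r →
      ∀ᶠ w in 𝓝 z, DifferentiableAt ℂ (psiQuot a b q m) w := fun m hm hmn z hz =>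
    psiQuot_eventually_differentiableAt hq (hA m hm) (fun i h1 h2 => hpole i h1 (h2.trans hmn)) hz
  refine ⟨hasLaurentExpansion_of_differentiableAt hr0 (hdiff n id le_rfl),
    fun k hk => hasLaurentExpansion_of_differentiableAt hr0
      (hdiff (k + 1) (fun h => absurd h k.succ_ne_zero) hk), ?_⟩
  have hcont : ∀ k < n, ContinuousOn (psiQuot a b q (k + 1)) (Metric.sphere 0 r) :=
    fun k hk z hz => (hdiff (k + 1) (fun h => absurd h k.succ_ne_zero) hk z
      (by simpa using hz)).self_of_nhds.continuousAt.continuousWithinAt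
  by_cases hn : n = 0
  · subst hn
    have h0 : InAnnulus a 1 b 1 b r := by simpa using hA 0 id
    have h1 := laurentCoeff_thetaQuot_zero hq h0
    rw [one_mul] at h1
    rw [Finset.range_zero, Finset.sum_empty, mul_zero, add_zero,
      ← eq_one_div_of_mul_eq_one_right h1]
    refine laurentCoeff_congr hr0 _ fun z _ => ?_
    simp only [psiQuot, thetaQuot, qPoch, Finset.range_zero, Finset.prod_empty, pow_zero, mul_one,
      one_mul]
    congr 1
    ring
  have hK : InAnnulus a 1 (b * q) 1 b r := by
    simpa using hA 1 (fun h => absurd h one_ne_zero)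
  refine eq_add_sum_invCoeff a b q _ (fun m => laurentCoeff r m (psiQuot a b q m))
    (fun k => laurentCoeff r k (psiQuot a b q (k + 1))) n (fun N hN hNn => ?_) n hn le_rfl
  rw [← laurentCoeff_kernel hq hK N]
  -- Both sides are the constant term of the kernel times `z⁻ᴺ`.
  have hshift : laurentCoeff r N (thetaQuot a 1 (b * q) 1 b q) =
      laurentCoeff r 0 (fun z => z ^ (-(N : ℤ)) * thetaQuot a 1 (b * q) 1 b q z) := by
    rw [laurentCoeff_zpow_mul hr0, zero_sub, neg_neg]
  set φ := baseSeries (a * q) (b * q) q with hφ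
  have hzc : ∀ (j : ℤ) (k : ℕ) (u : ℂ), k < n →
      ContinuousOn (fun z => u * (z ^ j * psiQuot a b q (k + 1) z)) (Metric.sphere 0 r) :=
    fun j k u hk => continuousOn_const.mul (ContinuousOn.mul (fun z hz =>
      (continuousAt_zpow₀ z j (Or.inl (ne_zero_of_norm_eq hr0 (by simpa using hz)))
        ).continuousWithinAt) (hcont k hk))
  have hterm : ∀ k ∈ Finset.range N,
      laurentCoeff r (k + 1 : ℕ) (psiQuot a b q (k + 1)) * PowerSeries.coeff N (φ (k + 1)) -
        a * q ^ (k + 1) * laurentCoeff r k (psiQuot a b q (k + 1)) *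
          PowerSeries.coeff N (PowerSeries.X * φ k) =
      laurentCoeff r 0 (fun z => PowerSeries.coeff N (φ (k + 1)) *
          (z ^ (-((k + 1 : ℕ) : ℤ)) * psiQuot a b q (k + 1) z) +
        -(a * q ^ (k + 1) * PowerSeries.coeff N (PowerSeries.X * φ k)) *
          (z ^ (-(k : ℤ)) * psiQuot a b q (k + 1) z)) := by
    intro k hk
    have hkn : k < n := (Finset.mem_range.1 hk).trans_le hNn
    rw [laurentCoeff_add hr0 _ (hzc _ _ _ hkn) (hzc _ _ _ hkn), laurentCoeff_const_mul,
      laurentCoeff_const_mul, laurentCoeff_zpow_mul hr0, laurentCoeff_zpow_mul hr0, zero_sub,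
      zero_sub, neg_neg, neg_neg]
    ring
  rw [hshift, Finset.sum_congr rfl hterm, ← laurentCoeff_sum hr0]
  · refine laurentCoeff_congr hr0 _ fun z hz => ?_
    have hz0 := ne_zero_of_norm_eq hr0 hz
    have htel := coeff_sum_baseSeries_telescope a b q z hz0 N (fun k hk h0 => ?_) hN
    · rw [zpow_neg, zpow_natCast, ← inv_pow, ← htel, Finset.sum_mul]
      refine Finset.sum_congr rfl fun k _ => ?_
      rw [psiQuot_succ_eq hq hK k hz, zpow_neg, zpow_neg, zpow_natCast, zpow_natCast, ← inv_pow,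
        ← inv_pow, pow_succ z⁻¹]
      have : z⁻¹ * z = 1 := inv_mul_cancel₀ hz0
      linear_combination (z⁻¹ ^ k * (a * q ^ (k + 1)) * PowerSeries.coeff N (PowerSeries.X * φ k) *
        (qPoch (b * q * z) q k / qPoch (a * q * z) q (k + 1) *
          thetaQuot a 1 (b * q) 1 b q z)) * this
    · refine hpole (k + 1) (by omega) (by omega) ?_
      have h2 : a * q ^ (k + 1) * z = 1 := by
        rw [pow_succ]
        linear_combination -h0
      rw [← hz, ← norm_mul, h2, norm_one]
  · intro k hk
    have hkn : k < n := (Finset.mem_range.1 hk).trans_le hNn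
    exact (hzc _ _ _ hkn).add (hzc _ _ _ hkn)
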